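/- Let $(\mathfrak H,(\cdot,\cdot))$ be a complex Hilbert space with a non-trivial fundamental symmetry $J$, i.e. $J$ is bounded, $J=J^*$, $J^2=I$ and $J\neq\pm I$. Put $[x,y]=(Jx,y)$ and $\mathfrak H_\pm=\frac12(I\pm J)\mathfrak H$. Let $S$ be a closed densely defined symmetric operator in $\mathfrak H$ with $SJ=JS$, and let $S_\pm=S\upharpoonright_{\mathfrak H_\pm}$, which are closed densely defined symmetric operators in $\mathfrak H_\pm$. Assume that $S_+$ and $S_-$ both have deficiency indices $\langle 1,1\rangle$, i.e. the four spaces $\ker(S_\pm^*-iI)$ and $\ker(S_\pm^*+iI)$ are one-dimensional. For a closed densely defined symmetric operator $T$ and $\mu\in\mathbb C_+=\{\mu:\operatorname{Im}\mu>0\}$ let $A_\mu$ be the restriction of $T^*$ to $\mathcal D(T)\dotplus\ker(T^*-\mu I)$. The Straus characteristic function of $T$ is $$\mathsf{Sh}_T(\mu)=(A_\mu-iI)(A_\mu+iI)^{-1}\upharpoonright_{\ker(T^*-iI)}:\ \ker(T^*-iI)\to\ker(T^*+iI),\qquad \mu\in\mathbb C_+ .$$ Let $e_{++},e_{-+},e_{+-},e_{--}$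 be vectors of equal norm spanning $\ker(S_+^*-iI)$, $\ker(S_+^*+iI)$, $\ker(S_-^*-iI)$, $\ker(S_-^*+iI)$ respectively, and let $s_\pm:\mathbb C_+\to\mathbb C$ be the functions determined by $$\mathsf{Sh}_{S_+}(\mu)e_{++}=s_+(\mu)e_{-+},\qquad \mathsf{Sh}_{S_-}(\mu)e_{+-}=s_-(\mu)e_{--},\qquad \mu\in\mathbb C_+ .$$ Then there exists a $J$-self-adjoint extension $A\supset S$ (a densely defined operator equal to its adjoint with respect to $[\cdot,\cdot]$) with empty resolvent set if and only if $s_+\approx s_-$, i.e. if and only if there is a constant $c\in\mathbb C$ with $|c|=1$ such that $c\,s_+(\mu)=s_-(\mu)$ for all $\mu\in\mathbb C_+$. -/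

import Mathlib

open scoped LinearPMap

noncomputable section

namespace KreinExt

section Hilbert

variable {H : Type*} [NormedAddCommGroup H] [InnerProductSpace ℂ H]

/-! ### Unbounded operators in a Hilbert space -/

/-- Closed densely defined symmetric operators. -/
structure IsClosedSymmetric (T : H →ₗ.[ℂ] H) : Prop where
  dense : Dense (T.domain : Set H)
  closed : T.IsClosed
  symmetric : T.IsFormalAdjoint T

/-- The resolvent set of an operator: those `μ` for which `A - μ` maps the domain of `A` bijectively
onto the whole space, with a bounded inverse `R`. -/
def resolventSet (A : H →ₗ.[ℂ] H) : Set ℂ :=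
  {μ | ∃ R : H →L[ℂ] H,
    (∀ y : H, ∃ h : R y ∈ A.domain, A ⟨R y, h⟩ - μ • R y = y) ∧
    ∀ x : A.domain, R (A x - μ • (x : H)) = x}

/-- The restriction of an operator `T` to a subspace `K` that it leaves invariant, as an operator
in `K` with domain `D(T) ∩ K`. -/
def restrict (T : H →ₗ.[ℂ] H) (K : Submodule ℂ H)
    (hK : ∀ x : T.domain, (x : H) ∈ K → T x ∈ K) : K →ₗ.[ℂ] K where
  domain := T.domain.comap K.subtype
  toFun :=
    { toFun := fun x => ⟨T ⟨((x : K) : H), x.2⟩, hK ⟨((x : K) : H), x.2⟩ (x : K).2⟩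
      map_add' := fun x y => Subtype.ext
        (T.map_add ⟨((x : K) : H), x.2⟩ ⟨((y : K) : H), y.2⟩)
      map_smul' := fun c x => Subtype.ext (T.map_smul c ⟨((x : K) : H), x.2⟩) }

/-- `A - z` as a linear map on the domain of `A`. -/
def shift (A : H →ₗ.[ℂ] H) (z : ℂ) : A.domain →ₗ[ℂ] H :=
  A.toFun - z • A.domain.subtype

/-- A closed symmetric operator that leaves `ran P` invariant and whose domain is invariant
under the bounded operator `P` restricts to a closed symmetric operator in `ran P`. -/
theorem restrict_isClosedSymmetric {T : H →ₗ.[ℂ] H} (hT : IsClosedSymmetric T) (P : H →L[ℂ] H)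
    (hD : ∀ x ∈ T.domain, P x ∈ T.domain)
    (hK : ∀ x : T.domain, (x : H) ∈ P.range → T x ∈ P.range) :
    IsClosedSymmetric (restrict T P.range hK) where
  dense := by
    have h1 : DenseRange (fun x : H => (⟨P x, ⟨x, rfl⟩⟩ : P.range)) := by
      refine Function.Surjective.denseRange ?_
      rintro ⟨_, x, rfl⟩
      exact ⟨x, rfl⟩
    have h2 := h1.dense_image (P.continuous.subtype_mk _) hT.dense
    refine h2.mono ?_
    rintro _ ⟨x, hx, rfl⟩
    exact hD x hx
  closed := by
    have h : ((restrict T P.range hK).graph : Set (P.range × P.range)) =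
        (fun p : P.range × P.range => ((p.1 : H), (p.2 : H))) ⁻¹' (T.graph : Set (H × H)) := by
      ext ⟨a, b⟩
      simp only [SetLike.mem_coe, LinearPMap.mem_graph_iff, Set.mem_preimage]
      constructor
      · rintro ⟨y, h1, h2⟩
        exact ⟨⟨((y : P.range) : H), y.2⟩, congrArg Subtype.val h1, congrArg Subtype.val h2⟩
      · rintro ⟨y, h1, h2⟩
        have ha : (a : H) ∈ T.domain := by
          have h1' : (y : H) = a := h1
          rw [← h1']; exact y.2
        refine ⟨⟨a, ha⟩, rfl, Subtype.ext ?_⟩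
        have hy : (⟨(a : H), ha⟩ : T.domain) = y := Subtype.ext h1.symm
        change T ⟨(a : H), ha⟩ = b
        rw [hy]; exact h2
    change IsClosed ((restrict T P.range hK).graph : Set (P.range × P.range))
    rw [h]
    exact IsClosed.preimage (by fun_prop) hT.closed
  symmetric := fun x y => hT.symmetric ⟨((x : P.range) : H), x.2⟩ ⟨((y : P.range) : H), y.2⟩

theorem IsClosedSymmetric.im_inner {T : H →ₗ.[ℂ] H} (hT : IsClosedSymmetric T) (x : T.domain) :
    (inner ℂ (x : H) (T x)).im = 0 := by
  have h := hT.symmetric x x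
  rw [← inner_conj_symm] at h
  exact Complex.conj_eq_iff_im.1 h

variable [CompleteSpace H]

/-- The defect subspace `ker (T* - μ)`. -/
def defect (T : H →ₗ.[ℂ] H) (μ : ℂ) : Submodule ℂ H :=
  T†.graph.comap (LinearMap.prod LinearMap.id (μ • LinearMap.id))

/-- `T` has deficiency indices `<1,1>`. -/
def HasDeficiencyIndicesOneOne (T : H →ₗ.[ℂ] H) : Prop :=
  Module.finrank ℂ (defect T Complex.I) = 1 ∧ Module.finrank ℂ (defect T (-Complex.I)) = 1

/-- The extension `A_μ` of `T` that is the restriction of `T*` to `D(T) + ker (T* - μ)`. -/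
def dissipativeExtension (T : H →ₗ.[ℂ] H) (μ : ℂ) : H →ₗ.[ℂ] H :=
  T†.domRestrict (T.domain ⊔ defect T μ)

/-! ### The operator `A_μ + i` is bijective -/

theorem mem_defect {T : H →ₗ.[ℂ] H} {μ : ℂ} {x : H} : x ∈ defect T μ ↔ (x, μ • x) ∈ T†.graph :=
  Iff.rfl

theorem mem_adjoint_graph {T : H →ₗ.[ℂ] H} (hT : Dense (T.domain : Set H)) {x y : H} :
    (x, y) ∈ T†.graph ↔ ∀ u : T.domain, inner ℂ (T u) x = inner ℂ (u : H) y := by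
  rw [LinearPMap.adjoint_graph_eq_graph_adjoint hT, Submodule.mem_adjoint_iff]
  constructor
  · intro h u
    exact sub_eq_zero.1 (h u (T u) (T.mem_graph u))
  · intro h a b hab
    obtain ⟨u, rfl, rfl⟩ := T.mem_graph_iff.1 hab
    exact sub_eq_zero.2 (h u)

/-- The basic estimate for `(A_μ + i) (x + n)`. -/
theorem IsClosedSymmetric.estimate {T : H →ₗ.[ℂ] H} (hT : IsClosedSymmetric T) {μ : ℂ}
    (x : T.domain) {n : H} (hn : n ∈ defect T μ) :
    μ.im * ‖n‖ ^ 2 + ‖(x : H) + n‖ ^ 2 ≤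
      ‖(x : H) + n‖ * ‖T x + Complex.I • (x : H) + (μ + Complex.I) • n‖ := by
  set f := T x + Complex.I • (x : H) + (μ + Complex.I) • n with hf
  have h1 : (inner ℂ ((x : H) + n) f).im = μ.im * ‖n‖ ^ 2 + ‖(x : H) + n‖ ^ 2 := by
    have hdec : f = (T x + μ • n) + Complex.I • ((x : H) + n) := by
      rw [hf]; module
    have hx := hT.im_inner x
    have hc : inner ℂ n (T x) = (starRingEnd ℂ) (inner ℂ (x : H) (μ • n)) := by
      rw [← (mem_adjoint_graph hT.dense).1 (mem_defect.1 hn) x, inner_conj_symm]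
    have hnn : (inner ℂ n (μ • n)).im = μ.im * ‖n‖ ^ 2 := by
      rw [inner_smul_right, inner_self_eq_norm_sq_to_K]
      simp [Complex.mul_im, ← Complex.ofReal_pow]
    have hii : (inner ℂ ((x : H) + n) (Complex.I • ((x : H) + n))).im = ‖(x : H) + n‖ ^ 2 := by
      rw [inner_smul_right, inner_self_eq_norm_sq_to_K]
      simp [Complex.mul_im, ← Complex.ofReal_pow]
    rw [hdec, inner_add_right, Complex.add_im, hii, inner_add_left, inner_add_right,
      inner_add_right, hc]
    simp only [Complex.add_im, Complex.conj_im, hx, hnn]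
    ring
  rw [← h1]
  exact (Complex.abs_im_le_norm _ |> (le_abs_self _).trans).trans (norm_inner_le_norm _ _)

theorem IsClosedSymmetric.bound {T : H →ₗ.[ℂ] H} (hT : IsClosedSymmetric T) {μ : ℂ}
    (hμ : 0 < μ.im) (x : T.domain) {n : H} (hn : n ∈ defect T μ) :
    ‖(x : H) + n‖ ≤ ‖T x + Complex.I • (x : H) + (μ + Complex.I) • n‖ ∧
    μ.im * ‖n‖ ^ 2 ≤ ‖T x + Complex.I • (x : H) + (μ + Complex.I) • n‖ ^ 2 := by
  have h := hT.estimate x hn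
  set a := ‖(x : H) + n‖
  set b := ‖T x + Complex.I • (x : H) + (μ + Complex.I) • n‖
  have ha : 0 ≤ a := norm_nonneg _
  have hb : 0 ≤ b := norm_nonneg _
  have hc : 0 ≤ μ.im * ‖n‖ ^ 2 := by positivity
  have hab : a ≤ b := by
    by_contra hlt
    push Not at hlt
    nlinarith
  exact ⟨hab, by nlinarith⟩

theorem IsClosedSymmetric.isClosed_range {T : H →ₗ.[ℂ] H} (hT : IsClosedSymmetric T) {μ : ℂ}
    (hμ : 0 < μ.im) (N : Submodule ℂ H) (hN : N ≤ defect T μ) (hNc : IsClosed (N : Set H)) :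
    IsClosed {f : H | ∃ (x : T.domain) (n : H), n ∈ N ∧
      f = T x + Complex.I • (x : H) + (μ + Complex.I) • n} := by
  have : CompleteSpace T.graph := hT.closed.completeSpace_coe
  have : CompleteSpace N := hNc.completeSpace_coe
  let F : (T.graph × N) →L[ℂ] H :=
    (ContinuousLinearMap.snd ℂ H H + Complex.I • ContinuousLinearMap.fst ℂ H H) ∘L
      T.graph.subtypeL ∘L ContinuousLinearMap.fst ℂ T.graph N +
    (μ + Complex.I) • (N.subtypeL ∘L ContinuousLinearMap.snd ℂ T.graph N)
  have hF : ∀ p : T.graph × N, F p =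
      (p.1 : H × H).2 + Complex.I • (p.1 : H × H).1 + (μ + Complex.I) • (p.2 : H) := fun p => rfl
  set c : ℝ := (Real.sqrt μ.im)⁻¹ with hcdef
  have hs : 0 < Real.sqrt μ.im := Real.sqrt_pos.2 hμ
  have hc : 0 < c := inv_pos.2 hs
  let K : ℝ := 2 + c + ‖μ + Complex.I‖ * c
  have hK : 0 ≤ K := by positivity
  have hb : ∀ p, ‖p‖ ≤ (⟨K, hK⟩ : NNReal) * ‖F p‖ := by
    rintro ⟨⟨⟨a, b⟩, hab⟩, ⟨n, hn⟩⟩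
    obtain ⟨x, rfl, rfl⟩ := T.mem_graph_iff.1 hab
    obtain ⟨h1, h2⟩ := hT.bound hμ x (hN hn)
    have hFp := hF ⟨⟨⟨(x : H), T x⟩, hab⟩, ⟨n, hn⟩⟩
    rw [hFp]
    set f := T x + Complex.I • (x : H) + (μ + Complex.I) • n with hf
    change _ ≤ K * ‖f‖
    have hn' : ‖n‖ ≤ c * ‖f‖ := by
      have h3 : Real.sqrt μ.im * ‖n‖ ≤ ‖f‖ := by
        refine le_of_sq_le_sq ?_ (norm_nonneg _)
        rw [mul_pow, Real.sq_sqrt hμ.le]; exact h2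
      rw [hcdef, inv_mul_eq_div, le_div_iff₀ hs]
      linarith
    have hx' : ‖(x : H)‖ ≤ (1 + c) * ‖f‖ := by
      have : (x : H) = ((x : H) + n) - n := by abel
      calc ‖(x : H)‖ = ‖((x : H) + n) - n‖ := by rw [← this]
        _ ≤ ‖(x : H) + n‖ + ‖n‖ := norm_sub_le _ _
        _ ≤ _ := by linarith
    have ht' : ‖T x‖ ≤ K * ‖f‖ := by
      have : T x = f - Complex.I • (x : H) - (μ + Complex.I) • n := by rw [hf]; abel
      calc ‖T x‖ = ‖f - Complex.I • (x : H) - (μ + Complex.I) • n‖ := by rw [← this]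
        _ ≤ ‖f‖ + ‖Complex.I • (x : H)‖ + ‖(μ + Complex.I) • n‖ :=
          (norm_sub_le _ _).trans (by gcongr; exact norm_sub_le _ _)
        _ = ‖f‖ + ‖(x : H)‖ + ‖μ + Complex.I‖ * ‖n‖ := by simp [norm_smul]
        _ ≤ ‖f‖ + (1 + c) * ‖f‖ + ‖μ + Complex.I‖ * (c * ‖f‖) := by gcongr
        _ = K * ‖f‖ := by simp only [K]; ring
    have hf0 := norm_nonneg f
    have hq : 0 ≤ ‖μ + Complex.I‖ * c * ‖f‖ := by positivity
    refine max_le (max_le ?_ ht') ?_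
    · change ‖(x : H)‖ ≤ K * ‖f‖
      refine hx'.trans ?_
      simp only [K]; nlinarith
    · change ‖n‖ ≤ K * ‖f‖
      refine hn'.trans ?_
      simp only [K]; nlinarith
  have hcl := (F.antilipschitz_of_bound hb).isClosed_range F.uniformContinuous
  convert hcl using 1
  ext f
  constructor
  · rintro ⟨x, n, hn, rfl⟩
    exact ⟨⟨⟨((x : H), T x), T.mem_graph x⟩, ⟨n, hn⟩⟩, rfl⟩
  · rintro ⟨⟨⟨⟨a, b⟩, hab⟩, ⟨n, hn⟩⟩, rfl⟩
    obtain ⟨x, rfl, rfl⟩ := T.mem_graph_iff.1 hab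
    exact ⟨x, n, hn, rfl⟩

theorem IsClosedSymmetric.isClosed_range_sub {T : H →ₗ.[ℂ] H} (hT : IsClosedSymmetric T) {z : ℂ}
    (hz : z.im ≠ 0) : IsClosed ((LinearMap.range (shift T z) : Submodule ℂ H) : Set H) := by
  have : CompleteSpace T.graph := hT.closed.completeSpace_coe
  let F : T.graph →L[ℂ] H :=
    (ContinuousLinearMap.snd ℂ H H - z • ContinuousLinearMap.fst ℂ H H) ∘L T.graph.subtypeL
  have hz' : 0 < |z.im| := abs_pos.2 hz
  let K : ℝ := 1 + (1 + ‖z‖) * |z.im|⁻¹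
  have hK : 0 ≤ K := by positivity
  have hb : ∀ p, ‖p‖ ≤ (⟨K, hK⟩ : NNReal) * ‖F p‖ := by
    rintro ⟨⟨a, b⟩, hab⟩
    obtain ⟨x, rfl, rfl⟩ := T.mem_graph_iff.1 hab
    change _ ≤ K * ‖T x - z • (x : H)‖
    set f := T x - z • (x : H) with hf
    have h1 : |z.im| * ‖(x : H)‖ ^ 2 ≤ ‖(x : H)‖ * ‖f‖ := by
      have h2 : (inner ℂ (x : H) f).im = - (z.im * ‖(x : H)‖ ^ 2) := by
        have h3 : (inner ℂ (x : H) (z • (x : H))).im = z.im * ‖(x : H)‖ ^ 2 := by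
          rw [inner_smul_right, inner_self_eq_norm_sq_to_K]
          simp [Complex.mul_im, ← Complex.ofReal_pow]
        rw [hf, inner_sub_right, Complex.sub_im, hT.im_inner, h3, zero_sub]
      have h4 := (Complex.abs_im_le_norm _).trans (norm_inner_le_norm (𝕜 := ℂ) (x : H) f)
      rwa [h2, abs_neg, abs_mul, abs_of_nonneg (by positivity : 0 ≤ ‖(x : H)‖ ^ 2)] at h4
    have hx : ‖(x : H)‖ ≤ |z.im|⁻¹ * ‖f‖ := by
      rw [inv_mul_eq_div, le_div_iff₀ hz']
      rcases (norm_nonneg (x : H)).eq_or_lt with h0 | h0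
      · rw [← h0]; simp
      · nlinarith
    have ht : ‖T x‖ ≤ K * ‖f‖ := by
      have : T x = f + z • (x : H) := by rw [hf]; abel
      calc ‖T x‖ = ‖f + z • (x : H)‖ := by rw [← this]
        _ ≤ ‖f‖ + ‖z‖ * ‖(x : H)‖ := (norm_add_le _ _).trans (by rw [norm_smul])
        _ ≤ ‖f‖ + ‖z‖ * (|z.im|⁻¹ * ‖f‖) := by gcongr
        _ ≤ K * ‖f‖ := by
          have : 0 ≤ |z.im|⁻¹ * ‖f‖ := by positivity
          simp only [K]; nlinarith
    refine max_le (hx.trans ?_) ht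
    have h5 : 0 ≤ ‖z‖ * |z.im|⁻¹ * ‖f‖ := by positivity
    have h6 := norm_nonneg f
    simp only [K]; nlinarith
  have hcl := (F.antilipschitz_of_bound hb).isClosed_range F.uniformContinuous
  convert hcl using 1
  ext f
  constructor
  · rintro ⟨x, rfl⟩
    exact ⟨⟨((x : H), T x), T.mem_graph x⟩, rfl⟩
  · rintro ⟨⟨⟨a, b⟩, hab⟩, rfl⟩
    obtain ⟨x, rfl, rfl⟩ := T.mem_graph_iff.1 hab
    exact ⟨x, rfl⟩

theorem isClosed_defect {T : H →ₗ.[ℂ] H} (hT : Dense (T.domain : Set H)) (μ : ℂ) :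
    IsClosed (defect T μ : Set H) := by
  have h : (defect T μ : Set H) = (fun x => (x, μ • x)) ⁻¹' (T†.graph : Set (H × H)) := rfl
  rw [h]
  exact IsClosed.preimage (by fun_prop) (LinearPMap.adjoint_isClosed hT)

/-- A vector orthogonal to `ran (T - conj μ)` lies in `ker (T* - μ)`. -/
theorem mem_defect_of_orthogonal {T : H →ₗ.[ℂ] H} (hT : Dense (T.domain : Set H)) {μ : ℂ} {v : H}
    (h : ∀ x : T.domain, inner ℂ (T x - (starRingEnd ℂ) μ • (x : H)) v = 0) : v ∈ defect T μ := by
  refine mem_defect.2 ((mem_adjoint_graph hT).2 fun u => ?_)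
  have h1 := h u
  rw [inner_sub_left, inner_smul_left, Complex.conj_conj, sub_eq_zero] at h1
  rw [h1, inner_smul_right]

theorem IsClosedSymmetric.exists_solution {T : H →ₗ.[ℂ] H} (hT : IsClosedSymmetric T) {μ : ℂ}
    (hμ : 0 < μ.im) (f : H) : ∃ (x : T.domain) (n : H), n ∈ defect T μ ∧
      f = T x + Complex.I • (x : H) + (μ + Complex.I) • n := by
  let R : Submodule ℂ H :=
    LinearMap.range (shift T (-Complex.I)) ⊔ (defect T μ).map ((μ + Complex.I) • LinearMap.id)
  have hR : (R : Set H) = {f : H | ∃ (x : T.domain) (n : H), n ∈ defect T μ ∧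
      f = T x + Complex.I • (x : H) + (μ + Complex.I) • n} := by
    ext g
    simp only [R, SetLike.mem_coe, Submodule.mem_sup, LinearMap.mem_range, Submodule.mem_map,
      Set.mem_ofPred_eq]
    constructor
    · rintro ⟨_, ⟨x, rfl⟩, _, ⟨n, hn, rfl⟩, rfl⟩
      refine ⟨x, n, hn, ?_⟩
      simp [shift]
    · rintro ⟨x, n, hn, rfl⟩
      refine ⟨_, ⟨x, rfl⟩, _, ⟨n, hn, rfl⟩, ?_⟩
      simp [shift]
  have hRc : IsClosed (R : Set H) :=
    hR ▸ hT.isClosed_range hμ _ le_rfl (isClosed_defect hT.dense μ)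
  have : CompleteSpace R := hRc.completeSpace_coe
  suffices h : R = ⊤ by
    have : f ∈ (R : Set H) := by rw [h]; trivial
    rw [hR] at this
    exact this
  rw [← Submodule.orthogonal_eq_bot_iff, Submodule.eq_bot_iff]
  intro v hv
  have hv1 : ∀ x : T.domain, inner ℂ (T x + Complex.I • (x : H)) v = 0 := by
    intro x
    refine (Submodule.mem_orthogonal _ _).1 hv _ (Submodule.mem_sup_left ⟨x, ?_⟩)
    simp [shift]
  have hv2 : ∀ n ∈ defect T μ, inner ℂ n v = 0 := by
    intro n hn
    have h0 : μ + Complex.I ≠ 0 := by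
      intro h
      have := congrArg Complex.im h
      simp at this
      linarith
    have h1 := (Submodule.mem_orthogonal _ _).1 hv _ (Submodule.mem_sup_right ⟨n, hn, rfl⟩)
    have h2 : (starRingEnd ℂ) (μ + Complex.I) * inner ℂ n v = 0 := by
      rw [← inner_smul_left]; exact h1
    exact (mul_eq_zero.1 h2).resolve_left ((map_ne_zero _).2 h0)
  let Q : Submodule ℂ H := LinearMap.range (shift T ((starRingEnd ℂ) μ))
  have hQc : IsClosed (Q : Set H) := hT.isClosed_range_sub (by simpa using hμ.ne')
  have : CompleteSpace Q := hQc.completeSpace_coe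
  have hvQ : v ∈ Q := by
    rw [← Submodule.orthogonal_orthogonal Q, Submodule.mem_orthogonal]
    intro n hn
    refine hv2 n (mem_defect_of_orthogonal hT.dense fun x => ?_)
    exact (Submodule.mem_orthogonal _ _).1 hn _ ⟨x, rfl⟩
  obtain ⟨x, rfl⟩ := hvQ
  have key := hv1 x
  have hsh : shift T ((starRingEnd ℂ) μ) x = T x - (starRingEnd ℂ) μ • (x : H) := rfl
  rw [hsh] at key ⊢
  have ht := hT.im_inner x
  have hsym : inner ℂ (T x) (x : H) = inner ℂ (x : H) (T x) := hT.symmetric x x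
  have hcs : ‖inner ℂ (x : H) (T x)‖ ≤ ‖(x : H)‖ * ‖T x‖ := norm_inner_le_norm _ _
  obtain ⟨t, htt⟩ : ∃ t : ℝ, inner ℂ (x : H) (T x) = (t : ℂ) :=
    ⟨_, (Complex.ext rfl (by simpa using ht))⟩
  rw [inner_add_left, inner_sub_right, inner_sub_right, inner_smul_left, inner_smul_left,
    inner_smul_right, inner_smul_right, hsym, htt, inner_self_eq_norm_sq_to_K,
    inner_self_eq_norm_sq_to_K] at key
  rw [htt, Complex.norm_real, Real.norm_eq_abs] at hcs
  have hre := congrArg Complex.re key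
  have him := congrArg Complex.im key
  simp [Complex.mul_re, Complex.mul_im, ← Complex.ofReal_pow] at hre him
  have hcs2 : t ^ 2 ≤ ‖(x : H)‖ ^ 2 * ‖T x‖ ^ 2 := by
    rw [← mul_pow, ← sq_abs]
    gcongr
  have hzero : ‖(x : H)‖ ^ 2 = 0 := by
    set a := ‖T x‖ ^ 2
    set n := ‖(x : H)‖ ^ 2
    have h1 : μ.im * (t ^ 2 + n ^ 2) ≤ 0 := by
      have h2 : n * a = (1 - μ.im) * t ^ 2 - μ.im * n ^ 2 := by
        linear_combination n * hre + t * him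
      linarith
    have h3 : t ^ 2 + n ^ 2 ≤ 0 := by
      by_contra hlt
      push Not at hlt
      linarith [mul_pos hμ hlt]
    nlinarith [sq_nonneg t, sq_nonneg n]
  have hx0 : (x : H) = 0 := by simpa using hzero
  have : x = 0 := Subtype.ext hx0
  subst this
  simp

theorem mem_dissipativeExtension_domain {T : H →ₗ.[ℂ] H} (hT : IsClosedSymmetric T) {μ : ℂ}
    {u : H} : u ∈ (dissipativeExtension T μ).domain ↔
      ∃ (x : T.domain) (n : H), n ∈ defect T μ ∧ u = (x : H) + n := by
  constructor
  · rintro ⟨h, -⟩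
    obtain ⟨x, hx, n, hn, rfl⟩ := Submodule.mem_sup.1 h
    exact ⟨⟨x, hx⟩, n, hn, rfl⟩
  · rintro ⟨x, n, hn, rfl⟩
    refine ⟨Submodule.mem_sup.2 ⟨x, x.2, n, hn, rfl⟩, ?_⟩
    exact Submodule.add_mem _ ((hT.symmetric.le_adjoint hT.dense).1 x.2)
      (LinearPMap.mem_domain_of_mem_graph (mem_defect.1 hn))

theorem dissipativeExtension_graph_le (T : H →ₗ.[ℂ] H) (μ : ℂ)
    (u : (dissipativeExtension T μ).domain) :
    ((u : H), dissipativeExtension T μ u) ∈ T†.graph :=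
  LinearPMap.le_graph_of_le LinearPMap.domRestrict_le (LinearPMap.mem_graph _ u)

theorem dissipativeExtension_apply {T : H →ₗ.[ℂ] H} (hT : IsClosedSymmetric T) {μ : ℂ}
    (u : (dissipativeExtension T μ).domain) (x : T.domain) {n : H} (hn : n ∈ defect T μ)
    (hu : (u : H) = (x : H) + n) : dissipativeExtension T μ u = T x + μ • n := by
  have h1 := dissipativeExtension_graph_le T μ u
  have h2 : ((x : H), T x) ∈ T†.graph :=
    LinearPMap.le_graph_of_le (hT.symmetric.le_adjoint hT.dense) (T.mem_graph x)
  have h3 := T†.graph.add_mem h2 (mem_defect.1 hn)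
  exact LinearPMap.mem_graph_snd_inj _ h1 h3 hu

theorem IsClosedSymmetric.bijective {T : H →ₗ.[ℂ] H} (hT : IsClosedSymmetric T) {μ : ℂ}
    (hμ : 0 < μ.im) : Function.Bijective (shift (dissipativeExtension T μ) (-Complex.I)) := by
  have hval : ∀ (u : (dissipativeExtension T μ).domain) (x : T.domain) (n : H),
      n ∈ defect T μ → (u : H) = (x : H) + n →
      shift (dissipativeExtension T μ) (-Complex.I) u =
        T x + Complex.I • (x : H) + (μ + Complex.I) • n := by
    intro u x n hn hu
    change dissipativeExtension T μ u - (-Complex.I) • (u : H) = _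
    rw [dissipativeExtension_apply hT u x hn hu, hu]
    module
  constructor
  · rw [← LinearMap.ker_eq_bot, LinearMap.ker_eq_bot']
    intro u hu
    obtain ⟨x, n, hn, hxn⟩ := (mem_dissipativeExtension_domain hT).1 u.2
    have h := (hT.bound hμ x hn).1
    rw [← hval u x n hn hxn, hu, norm_zero, ← hxn] at h
    exact Subtype.ext (norm_le_zero_iff.1 h)
  · intro f
    obtain ⟨x, n, hn, hf⟩ := hT.exists_solution hμ f
    refine ⟨⟨(x : H) + n, (mem_dissipativeExtension_domain hT).2 ⟨x, n, hn, rfl⟩⟩, ?_⟩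
    rw [hf]
    exact hval _ x n hn rfl

/-! ### The characteristic function -/

/-- The bijection `A_μ + i` from `D(A_μ)` onto the whole space. -/
def shiftEquiv {T : H →ₗ.[ℂ] H} (hT : IsClosedSymmetric T) {μ : ℂ} (hμ : 0 < μ.im) :
    (dissipativeExtension T μ).domain ≃ₗ[ℂ] H :=
  LinearEquiv.ofBijective (shift (dissipativeExtension T μ) (-Complex.I)) (hT.bijective hμ)

theorem shift_mem_defect {T : H →ₗ.[ℂ] H} (hT : IsClosedSymmetric T) {μ : ℂ} (hμ : 0 < μ.im)
    (f : defect T Complex.I) :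
    shift (dissipativeExtension T μ) Complex.I ((shiftEquiv hT hμ).symm f) ∈
      defect T (-Complex.I) := by
  set u := (shiftEquiv hT hμ).symm f with hu
  have h1 : dissipativeExtension T μ u - (-Complex.I) • (u : H) = f :=
    (shiftEquiv hT hμ).apply_symm_apply (f : H)
  have h2 : dissipativeExtension T μ u = f - Complex.I • (u : H) := by rw [← h1]; module
  have h3 := dissipativeExtension_graph_le T μ u
  have h4 : shift (dissipativeExtension T μ) Complex.I u = f - (2 * Complex.I) • (u : H) := by
    change dissipativeExtension T μ u - Complex.I • (u : H) = _
    rw [h2]; module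
  rw [h4, mem_defect]
  have h5 := T†.graph.sub_mem (mem_defect.1 f.2) (T†.graph.smul_mem (2 * Complex.I) h3)
  convert h5 using 1
  refine Prod.ext rfl ?_
  change (-Complex.I) • ((f : H) - (2 * Complex.I) • (u : H)) =
    Complex.I • (f : H) - (2 * Complex.I) • dissipativeExtension T μ u
  rw [h2]
  module

/-- The Straus characteristic function of a closed densely defined symmetric operator `T`,
`Sh(μ) = (A_μ - i) (A_μ + i)⁻¹ ↾ ker (T* - i)`, with values in `ker (T* + i)`. -/
def straus {T : H →ₗ.[ℂ] H} (hT : IsClosedSymmetric T) (μ : ℂ) (hμ : 0 < μ.im) :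
    defect T Complex.I →ₗ[ℂ] defect T (-Complex.I) :=
  LinearMap.codRestrict (defect T (-Complex.I))
    (shift (dissipativeExtension T μ) Complex.I ∘ₗ (shiftEquiv hT hμ).symm.toLinearMap ∘ₗ
      (defect T Complex.I).subtype)
    (shift_mem_defect hT hμ)

end Hilbert

/-! ### Fundamental symmetries -/

/-- A non-trivial fundamental symmetry: `J = J*`, `J² = I`, `J ≠ ± I`. -/
structure FundamentalSymmetry (H : Type*) [NormedAddCommGroup H] [InnerProductSpace ℂ H]
    [CompleteSpace H] where
  op : H →L[ℂ] H
  selfAdjoint : IsSelfAdjoint op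
  sq : ∀ x, op (op x) = x
  ne_id : op ≠ ContinuousLinearMap.id ℂ H
  ne_neg_id : op ≠ -ContinuousLinearMap.id ℂ H

section Krein

variable {H : Type*} [NormedAddCommGroup H] [InnerProductSpace ℂ H] [CompleteSpace H]

namespace FundamentalSymmetry

variable (J : FundamentalSymmetry H)

/-- `P₊ = (I + J) / 2`. -/
def projPlus : H →L[ℂ] H := (2⁻¹ : ℂ) • (ContinuousLinearMap.id ℂ H + J.op)

/-- `P₋ = (I - J) / 2`. -/
def projMinus : H →L[ℂ] H := (2⁻¹ : ℂ) • (ContinuousLinearMap.id ℂ H - J.op)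

/-- The positive part `P₊ H` of the fundamental decomposition. -/
def plus : Submodule ℂ H := J.projPlus.range

/-- The negative part `P₋ H` of the fundamental decomposition. -/
def minus : Submodule ℂ H := J.projMinus.range

theorem projPlus_apply (x : H) : J.projPlus x = (2⁻¹ : ℂ) • (x + J.op x) := rfl

theorem projMinus_apply (x : H) : J.projMinus x = (2⁻¹ : ℂ) • (x - J.op x) := rfl

theorem mem_plus {x : H} : x ∈ J.plus ↔ J.op x = x := by
  constructor
  · rintro ⟨y, rfl⟩
    change J.op (J.projPlus y) = J.projPlus y
    rw [projPlus_apply, map_smul, map_add, J.sq, add_comm]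
  · intro h
    refine ⟨x, ?_⟩
    change J.projPlus x = x
    rw [projPlus_apply, h]
    module

theorem mem_minus {x : H} : x ∈ J.minus ↔ J.op x = -x := by
  constructor
  · rintro ⟨y, rfl⟩
    change J.op (J.projMinus y) = -J.projMinus y
    rw [projMinus_apply, map_smul, map_sub, J.sq]
    module
  · intro h
    refine ⟨x, ?_⟩
    change J.projMinus x = x
    rw [projMinus_apply, h]
    module

instance : CompleteSpace J.plus := by
  have h : IsClosed (J.plus : Set H) := by
    have : (J.plus : Set H) = {x | J.op x = x} := Set.ext fun x => J.mem_plus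
    rw [this]
    exact isClosed_eq (by fun_prop) (by fun_prop)
  exact h.completeSpace_coe

instance : CompleteSpace J.minus := by
  have h : IsClosed (J.minus : Set H) := by
    have : (J.minus : Set H) = {x | J.op x = -x} := Set.ext fun x => J.mem_minus
    rw [this]
    exact isClosed_eq (by fun_prop) (by fun_prop)
  exact h.completeSpace_coe

/-- The indefinite inner product `[x, y] = (J x, y)`. -/
def form (x y : H) : ℂ := inner ℂ (J.op x) y

/-- `A` is `J`-self-adjoint: it is densely defined and equal to its adjoint with respect to the
indefinite inner product, the operator whose graph consists of the pairs `(x, y)` such that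
`[A u, x] = [u, y]` for all `u ∈ D(A)`. -/
def IsJSelfAdjoint (A : H →ₗ.[ℂ] H) : Prop :=
  Dense (A.domain : Set H) ∧
  ∀ x y : H, (x, y) ∈ A.graph ↔ ∀ u : A.domain, J.form (A u) x = J.form u y

/-- The operator identity `S J = J S`, equality of domains included. -/
def Commutes (S : H →ₗ.[ℂ] H) : Prop :=
  (∀ x : H, J.op x ∈ S.domain ↔ x ∈ S.domain) ∧
  ∀ (x : H) (hJx : J.op x ∈ S.domain) (hx : x ∈ S.domain), S ⟨J.op x, hJx⟩ = J.op (S ⟨x, hx⟩)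

variable {J} {S : H →ₗ.[ℂ] H}

theorem Commutes.invariant_plus (h : J.Commutes S) (x : S.domain) (hx : (x : H) ∈ J.plus) :
    S x ∈ J.plus := by
  have h1 := J.mem_plus.1 hx
  have h2 : J.op (x : H) ∈ S.domain := (h.1 x).2 x.2
  rw [J.mem_plus, ← h.2 x h2 x.2]
  exact congrArg S (Subtype.ext h1)

theorem Commutes.invariant_minus (h : J.Commutes S) (x : S.domain) (hx : (x : H) ∈ J.minus) :
    S x ∈ J.minus := by
  have h1 := J.mem_minus.1 hx
  have h2 : J.op (x : H) ∈ S.domain := (h.1 x).2 x.2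
  rw [J.mem_minus, ← h.2 x h2 x.2, ← LinearPMap.map_neg]
  exact congrArg S (Subtype.ext h1)

end FundamentalSymmetry

/-- `S₊ = S ↾ H₊`, an operator in `H₊`. -/
def plusPart (S : H →ₗ.[ℂ] H) {J : FundamentalSymmetry H} (h : J.Commutes S) :
    J.plus →ₗ.[ℂ] J.plus :=
  restrict S J.plus h.invariant_plus

/-- `S₋ = S ↾ H₋`, an operator in `H₋`. -/
def minusPart (S : H →ₗ.[ℂ] H) {J : FundamentalSymmetry H} (h : J.Commutes S) :
    J.minus →ₗ.[ℂ] J.minus :=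
  restrict S J.minus h.invariant_minus

theorem IsClosedSymmetric.plusPart {S : H →ₗ.[ℂ] H} (hS : IsClosedSymmetric S)
    {J : FundamentalSymmetry H} (h : J.Commutes S) : IsClosedSymmetric (plusPart S h) :=
  restrict_isClosedSymmetric hS J.projPlus
    (fun x hx => S.domain.smul_mem _ (S.domain.add_mem hx ((h.1 x).2 hx))) h.invariant_plus

theorem IsClosedSymmetric.minusPart {S : H →ₗ.[ℂ] H} (hS : IsClosedSymmetric S)
    {J : FundamentalSymmetry H} (h : J.Commutes S) : IsClosedSymmetric (minusPart S h) :=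
  restrict_isClosedSymmetric hS J.projMinus
    (fun x hx => S.domain.smul_mem _ (S.domain.sub_mem hx ((h.1 x).2 hx))) h.invariant_minus

end Krein

end KreinExt

end


/-!
By von Neumann's formula the extensions `A` of `S` inside `S*` correspond to the subspaces `W` of
`N_i × N_{-i}`, where `N_z = ker (S* - z)`, and Green's identity turns `J`-self-adjointness of `A`
into `W` being its own orthogonal complement for the form `[n, n'] - [m, m']`. The boundary values
of `ker (S* - μ)` are the pairs `(n, -Sh(μ) n)`, so `μ ∈ ρ(A)` if and only if `W` is complementary
to the graph of `-Sh(μ)`; as `dim W = 2`, this fails precisely when `W` contains some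
`(n, -Sh(μ) n)` with `n ≠ 0`.

If `ρ(A) = ∅`, then `Sh(i) = 0` provides `(f, 0) ∈ W` with `f` neutral. In the two-dimensional
indefinite space `N_i` the orthogonal complement of `f` is spanned by `f`, hence
`(f, -Sh(μ) f) ∈ W` for every `μ ∈ ℂ₊`, and neutrality of `W` on these vectors reads
`conj (s₊ ν) * s₊ μ = conj (s₋ ν) * s₋ μ`, which makes `s₊` and `s₋` proportional. Conversely, if
`c s₊ = s₋`, then `W = span {e₊₊ + e₊₋} × span {e₋₊ + c e₋₋}` contains
`(e₊₊ + e₊₋, -Sh(μ) (e₊₊ + e₊₋))` for every `μ`.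
-/

noncomputable section

namespace KreinExt

open FundamentalSymmetry

section Resolvent

variable {H : Type*} [NormedAddCommGroup H] [InnerProductSpace ℂ H] {A : H →ₗ.[ℂ] H} {μ : ℂ}

theorem bijective_shift_of_mem_resolventSet (h : μ ∈ resolventSet A) :
    Function.Bijective (shift A μ) := by
  obtain ⟨R, hR, hR'⟩ := h
  refine ⟨fun x x' hx => Subtype.ext ?_, fun y => ⟨⟨R y, (hR y).1⟩, (hR y).2⟩⟩
  calc (x : H) = R (shift A μ x) := (hR' x).symm
    _ = R (shift A μ x') := by rw [hx]
    _ = x' := hR' x'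

/-- The graph of `A` is a Hilbert space, mapped bijectively and continuously onto `H` by
`(x, y) ↦ y - μ x`, so the open mapping theorem applies. -/
theorem mem_resolventSet_of_bijective_shift [CompleteSpace H] (hA : A.IsClosed)
    (h : Function.Bijective (shift A μ)) : μ ∈ resolventSet A := by
  have : CompleteSpace A.graph := hA.completeSpace_coe
  let F : A.graph →L[ℂ] H :=
    (ContinuousLinearMap.snd ℂ H H - μ • ContinuousLinearMap.fst ℂ H H) ∘L A.graph.subtypeL
  have hF (x : A.domain) : F ⟨(x, A x), A.mem_graph x⟩ = shift A μ x := rfl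
  have hker : F.ker = ⊥ := by
    refine LinearMap.ker_eq_bot'.2 ?_
    rintro ⟨⟨a, b⟩, hab⟩ h0
    obtain ⟨x, rfl, rfl⟩ := A.mem_graph_iff.1 hab
    obtain rfl : x = 0 := h.1 (h0.trans (map_zero _).symm)
    simp
  have hrange : F.range = ⊤ := by
    refine LinearMap.range_eq_top.2 fun y => ?_
    obtain ⟨x, rfl⟩ := h.2 y
    exact ⟨_, hF x⟩
  let E := ContinuousLinearEquiv.ofBijective F hker hrange
  have hE (x : A.domain) : E.symm (shift A μ x) = ⟨(x, A x), A.mem_graph x⟩ :=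
    E.symm_apply_eq.2 (hF x).symm
  let R : H →L[ℂ] H :=
    ContinuousLinearMap.fst ℂ H H ∘L A.graph.subtypeL ∘L (E.symm : H →L[ℂ] A.graph)
  have hR (x : A.domain) : R (shift A μ x) = x := congrArg (fun p => p.1.1) (hE x)
  refine ⟨R, fun y => ?_, hR⟩
  obtain ⟨x, rfl⟩ := h.2 y
  rw [hR x]
  exact ⟨x.2, rfl⟩

theorem mem_resolventSet_iff_bijective_shift [CompleteSpace H] (hA : A.IsClosed) :
    μ ∈ resolventSet A ↔ Function.Bijective (shift A μ) :=
  ⟨bijective_shift_of_mem_resolventSet, mem_resolventSet_of_bijective_shift hA⟩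

theorem isOpen_resolventSet [CompleteSpace H] (A : H →ₗ.[ℂ] H) : IsOpen (resolventSet A) := by
  refine isOpen_iff_mem_nhds.2 fun z ⟨R, hR, hR'⟩ => ?_
  have hunits : {μ : ℂ | IsUnit (1 - (μ - z) • R)} ∈ nhds z := by
    refine (Units.isOpen.preimage (f := fun μ : ℂ => 1 - (μ - z) • R) (by fun_prop)).mem_nhds ?_
    simp
  filter_upwards [hunits] with μ ⟨U, hU⟩
  have hU_apply (x : H) : (U : H →L[ℂ] H) x = x - (μ - z) • R x := by rw [hU]; rfl
  have hcomm : Commute (U : H →L[ℂ] H) R := by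
    rw [hU]
    exact (Commute.one_left R).sub_left ((Commute.refl R).smul_left _)
  have hcomm' (x : H) : (↑U⁻¹ : H →L[ℂ] H) (R x) = R ((↑U⁻¹ : H →L[ℂ] H) x) :=
    congrArg (· x) hcomm.units_inv_left.eq
  have hinv (x : H) : (U : H →L[ℂ] H) ((↑U⁻¹ : H →L[ℂ] H) x) = x :=
    congrArg (· x) U.mul_inv
  have hinv' (x : H) : (↑U⁻¹ : H →L[ℂ] H) ((U : H →L[ℂ] H) x) = x :=
    congrArg (· x) U.inv_mul
  refine ⟨R ∘L (↑U⁻¹ : H →L[ℂ] H), fun y => ?_, fun x => ?_⟩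
  · obtain ⟨hx, hAx⟩ := hR ((↑U⁻¹ : H →L[ℂ] H) y)
    refine ⟨hx, ?_⟩
    calc A ⟨_, hx⟩ - μ • R ((↑U⁻¹ : H →L[ℂ] H) y)
        = (A ⟨_, hx⟩ - z • R ((↑U⁻¹ : H →L[ℂ] H) y)) - (μ - z) • R ((↑U⁻¹ : H →L[ℂ] H) y) := by
          module
      _ = (U : H →L[ℂ] H) ((↑U⁻¹ : H →L[ℂ] H) y) := by rw [hAx, hU_apply]
      _ = y := hinv y
  · calc R ((↑U⁻¹ : H →L[ℂ] H) (A x - μ • (x : H)))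
        = (↑U⁻¹ : H →L[ℂ] H) (R (A x - z • (x : H) - (μ - z) • (x : H))) := by
          rw [hcomm']; congr 2; module
      _ = (↑U⁻¹ : H →L[ℂ] H) ((U : H →L[ℂ] H) x) := by rw [map_sub, map_smul, hR', hU_apply]
      _ = x := hinv' x

end Resolvent

section JSelfAdjoint

variable {H : Type*} [NormedAddCommGroup H] [InnerProductSpace ℂ H] [CompleteSpace H]
  {J : FundamentalSymmetry H} {A : H →ₗ.[ℂ] H}

namespace FundamentalSymmetry

theorem inner_op (J : FundamentalSymmetry H) (x y : H) :
    inner ℂ (J.op x) y = inner ℂ x (J.op y) := by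
  rw [← ContinuousLinearMap.adjoint_inner_right, J.selfAdjoint.adjoint_eq]

theorem IsJSelfAdjoint.isClosed (hA : J.IsJSelfAdjoint A) : A.IsClosed := by
  have hgraph : (A.graph : Set (H × H)) =
      ⋂ u : A.domain, {p | J.form (A u) p.1 = J.form u p.2} := by
    ext p
    simpa only [Set.mem_iInter] using! hA.2 p.1 p.2
  rw [LinearPMap.IsClosed, hgraph]
  refine isClosed_iInter fun u => isClosed_eq ?_ ?_ <;> unfold form <;> fun_prop

/-- The resolvent at `conj z` is the adjoint, with respect to `[·, ·]`, of the resolvent at `z`. -/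
theorem IsJSelfAdjoint.conj_mem_resolventSet (hA : J.IsJSelfAdjoint A) {z : ℂ}
    (hz : z ∈ resolventSet A) : (starRingEnd ℂ) z ∈ resolventSet A := by
  obtain ⟨R, hR, hR'⟩ := hz
  let R' : H →L[ℂ] H := J.op ∘L R.adjoint ∘L J.op
  have hform (x y : H) : J.form (R x) y = J.form x (R' y) := by
    change inner ℂ (J.op (R x)) y = inner ℂ (J.op x) (J.op (R.adjoint (J.op y)))
    rw [J.inner_op, ← J.inner_op (J.op x), J.sq, ContinuousLinearMap.adjoint_inner_right]
  have hmem (y : H) : (R' y, y + (starRingEnd ℂ) z • R' y) ∈ A.graph := by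
    refine (hA.2 _ _).2 fun u => ?_
    have hu : J.form u y = J.form (A u - z • (u : H)) (R' y) := by rw [← hform, hR' u]
    rw [form, form] at hu ⊢
    rw [inner_add_right, hu, map_sub, map_smul, inner_sub_left, inner_smul_left, inner_smul_right]
    ring
  refine ⟨R', fun y => ?_, fun x => ?_⟩
  · have hy := A.mem_domain_of_mem_graph (hmem y)
    have hAy : A ⟨R' y, hy⟩ = y + (starRingEnd ℂ) z • R' y :=
      A.mem_graph_snd_inj (A.mem_graph ⟨R' y, hy⟩) (hmem y) rfl
    exact ⟨hy, by rw [hAy, add_sub_cancel_right]⟩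
  · refine ext_inner_left ℂ fun v => ?_
    rw [← J.sq v]
    change J.form (J.op v) (R' _) = J.form (J.op v) x
    obtain ⟨hu, hAu⟩ := hR (J.op v)
    have hx := (hA.2 x (A x)).1 (A.mem_graph x) ⟨R (J.op v), hu⟩
    rw [← hform]
    nth_rewrite 2 [← hAu]
    rw [form, form] at hx ⊢
    rw [map_sub, map_smul, inner_sub_left, inner_smul_left, hx, inner_sub_right, inner_smul_right]

/-- By symmetry about the real axis, a nonempty resolvent set which misses the open upper half plane
would be an open set contained in the real axis. -/
theorem IsJSelfAdjoint.resolventSet_eq_empty_iff (hA : J.IsJSelfAdjoint A) :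
    resolventSet A = ∅ ↔ ∀ μ : ℂ, 0 < μ.im → μ ∉ resolventSet A := by
  refine ⟨fun h μ _ => h ▸ Set.notMem_empty μ, fun h => ?_⟩
  refine Set.eq_empty_of_forall_notMem fun z hz => ?_
  have him (w : ℂ) (hw : w ∈ resolventSet A) : w.im < 0 := by
    have hsub : resolventSet A ⊆ {w | w.im ≤ 0} := fun w hw => not_lt.1 fun hpos => h w hpos hw
    have := interior_maximal hsub (isOpen_resolventSet A) hw
    rwa [Complex.interior_setOfPred_im_le] at this
  have hconj := him _ (hA.conj_mem_resolventSet hz)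
  rw [Complex.conj_im] at hconj
  linarith [him z hz]

end FundamentalSymmetry

end JSelfAdjoint

section VonNeumann

variable {H : Type*} [NormedAddCommGroup H] [InnerProductSpace ℂ H] [CompleteSpace H]
  {T : H →ₗ.[ℂ] H} {z : ℂ}

theorem IsClosedSymmetric.apply_mem_adjoint_graph (hT : IsClosedSymmetric T) (u : T.domain) :
    ((u : H), T u) ∈ T†.graph :=
  LinearPMap.le_graph_of_le (hT.symmetric.le_adjoint hT.dense) (T.mem_graph u)

theorem inner_shift_conj_eq_zero (hT : Dense (T.domain : Set H)) {n : H} (hn : n ∈ defect T z)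
    (u : T.domain) : inner ℂ (shift T ((starRingEnd ℂ) z) u) n = 0 := by
  change inner ℂ (T u - (starRingEnd ℂ) z • (u : H)) n = 0
  rw [inner_sub_left, inner_smul_left, Complex.conj_conj,
    (mem_adjoint_graph hT).1 (mem_defect.1 hn), inner_smul_right, sub_self]

theorem IsClosedSymmetric.exists_eq_shift_add (hT : IsClosedSymmetric T) (hz : z.im ≠ 0) (f : H) :
    ∃ (u : T.domain), ∃ n ∈ defect T ((starRingEnd ℂ) z), f = shift T z u + n := by
  have : CompleteSpace (LinearMap.range (shift T z)) :=
    (hT.isClosed_range_sub hz).completeSpace_coe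
  obtain ⟨_, ⟨u, rfl⟩, n, hn, rfl⟩ :=
    (LinearMap.range (shift T z)).exists_add_mem_mem_orthogonal f
  refine ⟨u, n, mem_defect_of_orthogonal hT.dense fun x => ?_, rfl⟩
  rw [Complex.conj_conj]
  exact (Submodule.mem_orthogonal _ _).1 hn _ ⟨x, rfl⟩

theorem IsClosedSymmetric.exists_adjoint_sub_smul_eq (hT : IsClosedSymmetric T) (hz : z.im ≠ 0)
    (f : H) : ∃ x y : H, (x, y) ∈ T†.graph ∧ y - z • x = f := by
  obtain ⟨u, n, hn, rfl⟩ := hT.exists_eq_shift_add hz f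
  have hne : (starRingEnd ℂ) z - z ≠ 0 := fun h => hz (Complex.conj_eq_iff_im.1 (sub_eq_zero.1 h))
  set m := ((starRingEnd ℂ) z - z)⁻¹ • n
  have hmn : ((starRingEnd ℂ) z - z) • m = n := smul_inv_smul₀ hne n
  refine ⟨u + m, T u + (starRingEnd ℂ) z • m, T†.graph.add_mem (hT.apply_mem_adjoint_graph u)
    (mem_defect.1 (Submodule.smul_mem _ _ hn)), ?_⟩
  rw [← hmn]
  change _ = T u - z • (u : H) + _
  module

theorem IsClosedSymmetric.disjoint_domain_defect (hT : IsClosedSymmetric T) (hz : z.im ≠ 0) :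
    Disjoint T.domain (defect T z) := by
  refine Submodule.disjoint_def.2 fun x hx hxz => ?_
  have hTx : T ⟨x, hx⟩ = z • x :=
    LinearPMap.mem_graph_snd_inj _ (hT.apply_mem_adjoint_graph ⟨x, hx⟩) (mem_defect.1 hxz) rfl
  have h := inner_shift_conj_eq_zero hT.dense hxz ⟨x, hx⟩
  change inner ℂ (T ⟨x, hx⟩ - (starRingEnd ℂ) z • x) x = 0 at h
  have hne : (starRingEnd ℂ) z - z ≠ 0 := fun h => hz (Complex.conj_eq_iff_im.1 (sub_eq_zero.1 h))
  rw [hTx, ← sub_smul, inner_smul_left, map_sub, Complex.conj_conj] at h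
  exact inner_self_eq_zero.1 ((mul_eq_zero.1 h).resolve_left hne)

/-- The summation map `N_i × N_{-i} → H` of von Neumann's formula
`D(T*) = D(T) ∔ N_i ∔ N_{-i}`, where `N_z = ker (T* - z)`. -/
def defectSum (T : H →ₗ.[ℂ] H) : (defect T Complex.I × defect T (-Complex.I)) →ₗ[ℂ] H :=
  (defect T Complex.I).subtype.coprod (defect T (-Complex.I)).subtype

theorem defectSum_apply (p : defect T Complex.I × defect T (-Complex.I)) :
    defectSum T p = p.1 + p.2 := rfl

theorem defectSum_mem_adjoint_graph (p : defect T Complex.I × defect T (-Complex.I)) :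
    (defectSum T p, Complex.I • ((p.1 : H) - p.2)) ∈ T†.graph := by
  convert T†.graph.add_mem (mem_defect.1 p.1.2) (mem_defect.1 p.2.2) using 1
  refine Prod.ext rfl ?_
  change Complex.I • ((p.1 : H) - p.2) = Complex.I • (p.1 : H) + -Complex.I • (p.2 : H)
  module

theorem IsClosedSymmetric.exists_sub_defectSum_mem (hT : IsClosedSymmetric T) {x : H}
    (hx : x ∈ T†.domain) : ∃ p, x - defectSum T p ∈ T.domain := by
  obtain ⟨u, n, hn, h⟩ := hT.exists_eq_shift_add (z := -Complex.I) (by simp)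
    (T† ⟨x, hx⟩ - (-Complex.I) • x)
  replace hn : (2 * Complex.I)⁻¹ • n ∈ defect T Complex.I :=
    Submodule.smul_mem _ _ (by simpa using hn)
  set p := (2 * Complex.I)⁻¹ • n
  have hpn : (2 * Complex.I) • p = n := smul_inv_smul₀ (by simp) n
  have hm : x - u - p ∈ defect T (-Complex.I) := by
    rw [mem_defect]
    convert T†.graph.sub_mem (T†.graph.sub_mem (T†.mem_graph ⟨x, hx⟩)
      (hT.apply_mem_adjoint_graph u)) (mem_defect.1 hn) using 1
    refine Prod.ext rfl ?_
    change -Complex.I • (x - u - p) = T† ⟨x, hx⟩ - T u - Complex.I • p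
    rw [sub_eq_iff_eq_add.1 h, ← hpn]
    change _ = T u - (-Complex.I) • (u : H) + _ + _ - _ - _
    module
  refine ⟨(⟨p, hn⟩, ⟨_, hm⟩), ?_⟩
  have hu : x - defectSum T (⟨p, hn⟩, ⟨_, hm⟩) = u := by
    rw [defectSum_apply]
    module
  rw [hu]
  exact u.2

theorem IsClosedSymmetric.defectSum_mem_domain_iff (hT : IsClosedSymmetric T)
    {p : defect T Complex.I × defect T (-Complex.I)} : defectSum T p ∈ T.domain ↔ p = 0 := by
  refine ⟨fun h => ?_, fun h => by simp [h]⟩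
  have hTp : T ⟨defectSum T p, h⟩ = Complex.I • ((p.1 : H) - p.2) :=
    LinearPMap.mem_graph_snd_inj _ (hT.apply_mem_adjoint_graph ⟨_, h⟩)
      (defectSum_mem_adjoint_graph p) rfl
  have hshift (z : ℂ) : shift T z ⟨defectSum T p, h⟩ =
      (Complex.I - z) • (p.1 : H) - (Complex.I + z) • (p.2 : H) := by
    change T ⟨_, h⟩ - z • defectSum T p = _
    rw [hTp, defectSum_apply]
    module
  have h1 := inner_shift_conj_eq_zero hT.dense p.1.2 ⟨_, h⟩
  have h2 := inner_shift_conj_eq_zero hT.dense p.2.2 ⟨_, h⟩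
  rw [hshift] at h1 h2
  refine Prod.ext (Subtype.ext ?_) (Subtype.ext ?_)
  · simpa [inner_smul_left] using h1
  · simpa [inner_smul_left] using h2

end VonNeumann

section Straus

variable {H : Type*} [NormedAddCommGroup H] [InnerProductSpace ℂ H] [CompleteSpace H]
  {T : H →ₗ.[ℂ] H} (hT : IsClosedSymmetric T) {μ : ℂ} (hμ : 0 < μ.im)

theorem coe_straus_apply (e : defect T Complex.I) :
    (straus hT μ hμ e : H) = e - (2 * Complex.I) • ((shiftEquiv hT hμ).symm e : H) := by
  set v := (shiftEquiv hT hμ).symm e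
  have hv : dissipativeExtension T μ v - (-Complex.I) • (v : H) = e :=
    (shiftEquiv hT hμ).apply_symm_apply (e : H)
  change dissipativeExtension T μ v - Complex.I • (v : H) = _
  rw [← hv]
  module

include hT hμ in
theorem disjoint_sup_defect_neg_I :
    Disjoint (T.domain ⊔ defect T μ) (defect T (-Complex.I)) := by
  refine Submodule.disjoint_def.2 fun x hx hx' => ?_
  let u : (dissipativeExtension T μ).domain :=
    ⟨x, hx, LinearPMap.mem_domain_of_mem_graph (mem_defect.1 hx')⟩
  have hu : dissipativeExtension T μ u = -Complex.I • x :=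
    LinearPMap.mem_graph_snd_inj _ (dissipativeExtension_graph_le T μ u) (mem_defect.1 hx') rfl
  have h0 : shift (dissipativeExtension T μ) (-Complex.I) u = 0 := sub_eq_zero.2 hu
  exact congrArg Subtype.val ((hT.bijective hμ).1 (h0.trans (map_zero _).symm))

theorem straus_apply_eq_iff {e : defect T Complex.I} {e' : defect T (-Complex.I)} :
    straus hT μ hμ e = e' ↔ (e : H) - e' ∈ T.domain ⊔ defect T μ := by
  have hstraus : (e : H) - straus hT μ hμ e ∈ T.domain ⊔ defect T μ := by
    rw [coe_straus_apply, sub_sub_cancel]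
    exact Submodule.smul_mem _ _ ((shiftEquiv hT hμ).symm e).2.1
  refine ⟨fun h => h ▸ hstraus, fun h => Subtype.ext (sub_eq_zero.1 ?_)⟩
  refine Submodule.disjoint_def.1 (disjoint_sup_defect_neg_I hT hμ) _ ?_
    (Submodule.sub_mem _ (straus hT μ hμ e).2 e'.2)
  simpa using Submodule.sub_mem _ h hstraus

theorem straus_I : straus hT Complex.I (by simp) = 0 := by
  ext1 e
  exact (straus_apply_eq_iff hT _).2 (Submodule.mem_sup_right (by simp))

theorem defectSum_mem_sup_defect_iff {p : defect T Complex.I × defect T (-Complex.I)} :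
    defectSum T p ∈ T.domain ⊔ defect T μ ↔ p ∈ (-straus hT μ hμ).graph := by
  rw [LinearMap.mem_graph_iff, LinearMap.neg_apply, eq_comm, neg_eq_iff_eq_neg,
    straus_apply_eq_iff, NegMemClass.coe_neg, sub_neg_eq_add, defectSum_apply]

end Straus

section IntermediateExtension

variable {H : Type*} [NormedAddCommGroup H] [InnerProductSpace ℂ H] [CompleteSpace H]
  {T A : H →ₗ.[ℂ] H} {μ : ℂ}

/-- The boundary values `p ∈ N_i × N_{-i}` of the elements of `D(A)`, for an operator `A` between
`T` and `T*`; by von Neumann's formula it determines `A`. -/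
def boundarySpace (T A : H →ₗ.[ℂ] H) : Submodule ℂ (defect T Complex.I × defect T (-Complex.I)) :=
  A.domain.comap (defectSum T)

theorem mem_domain_iff_mem_boundarySpace (hTA : T ≤ A) {x : H}
    {p : defect T Complex.I × defect T (-Complex.I)} (h : x - defectSum T p ∈ T.domain) :
    x ∈ A.domain ↔ p ∈ boundarySpace T A := by
  rw [boundarySpace, Submodule.mem_comap, ← sub_add_cancel x (defectSum T p)]
  exact Submodule.add_mem_iff_right _ (hTA.1 h)

theorem shift_apply_eq_iff (hAT : A ≤ T†) (a : A.domain) {x y : H} (hxy : (x, y) ∈ T†.graph) :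
    shift A μ a = y - μ • x ↔ x - a ∈ defect T μ := by
  have ha : (x - a, y - A a) ∈ T†.graph :=
    T†.graph.sub_mem hxy (LinearPMap.le_graph_of_le hAT (A.mem_graph a))
  have hiff : shift A μ a = y - μ • x ↔ y - A a = μ • (x - a) := by
    change A a - μ • (a : H) = y - μ • x ↔ _
    rw [smul_sub, eq_comm, sub_eq_sub_iff_sub_eq_sub]
  rw [hiff, mem_defect]
  exact ⟨fun h => h ▸ ha, fun h => LinearPMap.mem_graph_snd_inj _ ha h rfl⟩

theorem injective_shift_iff_disjoint_defect (hAT : A ≤ T†) :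
    Function.Injective (shift A μ) ↔ Disjoint A.domain (defect T μ) := by
  have hker (a : A.domain) : shift A μ a = 0 ↔ (a : H) ∈ defect T μ := by
    simpa using shift_apply_eq_iff hAT a T†.graph.zero_mem
  simp only [injective_iff_map_eq_zero, hker, Submodule.disjoint_def, Subtype.forall,
    Submodule.mk_eq_zero]

theorem surjective_shift_iff_adjoint_domain_le (hT : IsClosedSymmetric T) (hAT : A ≤ T†)
    (hμ : μ.im ≠ 0) :
    Function.Surjective (shift A μ) ↔ T†.domain ≤ A.domain ⊔ defect T μ := by
  constructor
  · intro h x hx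
    obtain ⟨a, ha⟩ := h (T† ⟨x, hx⟩ - μ • x)
    rw [← add_sub_cancel (a : H) x]
    exact Submodule.add_mem_sup a.2 ((shift_apply_eq_iff hAT a (T†.mem_graph ⟨x, hx⟩)).1 ha)
  · intro h f
    obtain ⟨x, y, hxy, rfl⟩ := hT.exists_adjoint_sub_smul_eq hμ f
    obtain ⟨a, ha, n, hn, rfl⟩ := Submodule.mem_sup.1 (h (LinearPMap.mem_domain_of_mem_graph hxy))
    exact ⟨⟨a, ha⟩, (shift_apply_eq_iff hAT ⟨a, ha⟩ hxy).2 (by simpa using hn)⟩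

theorem disjoint_defect_iff_disjoint_boundarySpace (hT : IsClosedSymmetric T) (hTA : T ≤ A)
    (hAT : A ≤ T†) (hμ : 0 < μ.im) :
    Disjoint A.domain (defect T μ) ↔
      Disjoint (boundarySpace T A) (-straus hT μ hμ).graph := by
  simp only [Submodule.disjoint_def]
  constructor
  · intro h p hpA hpμ
    obtain ⟨u, hu, n, hn, hp⟩ := Submodule.mem_sup.1 ((defectSum_mem_sup_defect_iff hT hμ).2 hpμ)
    have hnA : n ∈ A.domain := by
      rw [← add_sub_cancel_left u n, hp]
      exact Submodule.sub_mem _ hpA (hTA.1 hu)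
    rw [← hT.defectSum_mem_domain_iff, ← hp, h n hnA hn, add_zero]
    exact hu
  · intro h x hxA hxμ
    obtain ⟨p, hp⟩ := hT.exists_sub_defectSum_mem (hAT.1 hxA)
    have hp0 : p = 0 := by
      refine h p ((mem_domain_iff_mem_boundarySpace hTA hp).1 hxA) ?_
      rw [← defectSum_mem_sup_defect_iff, ← sub_sub_cancel x (defectSum T p)]
      exact Submodule.sub_mem _ (Submodule.mem_sup_right hxμ) (Submodule.mem_sup_left hp)
    rw [hp0, map_zero, sub_zero] at hp
    exact Submodule.disjoint_def.1 (hT.disjoint_domain_defect hμ.ne') x hp hxμ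

theorem adjoint_domain_le_iff_codisjoint_boundarySpace (hT : IsClosedSymmetric T) (hTA : T ≤ A)
    (hAT : A ≤ T†) (hμ : 0 < μ.im) :
    T†.domain ≤ A.domain ⊔ defect T μ ↔
      Codisjoint (boundarySpace T A) (-straus hT μ hμ).graph := by
  rw [Submodule.codisjoint_iff_exists_add_eq]
  constructor
  · intro h p
    obtain ⟨a, ha, n, hn, hp⟩ := Submodule.mem_sup.1
      (h (LinearPMap.mem_domain_of_mem_graph (defectSum_mem_adjoint_graph p)))
    obtain ⟨q, hq⟩ := hT.exists_sub_defectSum_mem (hAT.1 ha)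
    refine ⟨q, p - q, (mem_domain_iff_mem_boundarySpace hTA hq).1 ha, ?_, add_sub_cancel _ _⟩
    rw [← defectSum_mem_sup_defect_iff, map_sub, ← hp, add_sub_right_comm]
    exact Submodule.add_mem_sup hq hn
  · intro h x hx
    obtain ⟨p, hp⟩ := hT.exists_sub_defectSum_mem hx
    obtain ⟨w, g, hw, hg, rfl⟩ := h p
    obtain ⟨u, hu, n, hn, hug⟩ := Submodule.mem_sup.1 ((defectSum_mem_sup_defect_iff hT hμ).2 hg)
    have hx : x = (x - defectSum T (w + g) + defectSum T w + u) + n := by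
      rw [map_add, ← hug]
      abel
    rw [hx]
    exact Submodule.add_mem_sup (add_mem (add_mem (hTA.1 hp) hw) (hTA.1 hu)) hn

theorem mem_resolventSet_iff_isCompl (hT : IsClosedSymmetric T) (hA : A.IsClosed) (hTA : T ≤ A)
    (hAT : A ≤ T†) (hμ : 0 < μ.im) :
    μ ∈ resolventSet A ↔ IsCompl (boundarySpace T A) (-straus hT μ hμ).graph := by
  rw [mem_resolventSet_iff_bijective_shift hA, Function.Bijective, isCompl_iff,
    injective_shift_iff_disjoint_defect hAT,
    surjective_shift_iff_adjoint_domain_le hT hAT hμ.ne',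
    disjoint_defect_iff_disjoint_boundarySpace hT hTA hAT hμ,
    adjoint_domain_le_iff_codisjoint_boundarySpace hT hTA hAT hμ]

/-- The restriction of `T*` to the elements of `D(T*)` with boundary values in `W`. -/
def extension (T : H →ₗ.[ℂ] H) (W : Submodule ℂ (defect T Complex.I × defect T (-Complex.I))) :
    H →ₗ.[ℂ] H :=
  T†.domRestrict (T.domain ⊔ W.map (defectSum T))

variable (W : Submodule ℂ (defect T Complex.I × defect T (-Complex.I)))

theorem extension_le_adjoint : extension T W ≤ T† := LinearPMap.domRestrict_le

theorem le_extension (hT : IsClosedSymmetric T) : T ≤ extension T W := by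
  have hTT : T ≤ T† := hT.symmetric.le_adjoint hT.dense
  exact ⟨fun x hx => ⟨Submodule.mem_sup_left hx, hTT.1 hx⟩, fun x y hxy => hTT.2 hxy⟩

theorem boundarySpace_extension (hT : IsClosedSymmetric T) :
    boundarySpace T (extension T W) = W := by
  ext p
  constructor
  · rintro ⟨hp, -⟩
    obtain ⟨u, hu, _, ⟨w, hw, rfl⟩, huw⟩ := Submodule.mem_sup.1 hp
    have hpw : defectSum T (p - w) ∈ T.domain := by
      rwa [map_sub, ← huw, add_sub_cancel_right]
    rwa [sub_eq_zero.1 (hT.defectSum_mem_domain_iff.1 hpw)]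
  · exact fun hp => ⟨Submodule.mem_sup_right (Submodule.mem_map_of_mem hp),
      LinearPMap.mem_domain_of_mem_graph (defectSum_mem_adjoint_graph p)⟩

end IntermediateExtension

/-- A subspace equal to its orthogonal complement with respect to the form `B`. -/
def IsHypermaximalNeutral {E : Type*} [AddCommGroup E] [Module ℂ E] (B : E → E → ℂ)
    (W : Submodule ℂ E) : Prop :=
  ∀ p, p ∈ W ↔ ∀ q ∈ W, B q p = 0

section GreenIdentity

variable {H : Type*} [NormedAddCommGroup H] [InnerProductSpace ℂ H] [CompleteSpace H]
  {J : FundamentalSymmetry H} {S A : H →ₗ.[ℂ] H} {x y : H}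
  {p : defect S Complex.I × defect S (-Complex.I)}

namespace FundamentalSymmetry

theorem op_injective (J : FundamentalSymmetry H) : Function.Injective J.op :=
  Function.Involutive.injective J.sq

theorem conj_form (J : FundamentalSymmetry H) (x y : H) :
    (starRingEnd ℂ) (J.form x y) = J.form y x := by
  rw [form, form, inner_conj_symm, J.inner_op]

theorem Commutes.mem_adjoint_graph_iff (hSJ : J.Commutes S) (hS : Dense (S.domain : Set H)) :
    (x, y) ∈ S†.graph ↔ ∀ u : S.domain, J.form (S u) x = J.form u y := by
  have hJS (u : S.domain) : S ⟨J.op u, (hSJ.1 u).2 u.2⟩ = J.op (S u) := hSJ.2 u _ u.2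
  rw [mem_adjoint_graph hS]
  simp only [form, ← hJS]
  refine ⟨fun h u => h ⟨J.op u, _⟩, fun h u => ?_⟩
  have hu : (⟨J.op (J.op u), (hSJ.1 _).2 ((hSJ.1 u).2 u.2)⟩ : S.domain) = u :=
    Subtype.ext (J.sq u)
  simpa only [hu, J.sq] using h ⟨J.op u, (hSJ.1 u).2 u.2⟩

theorem IsJSelfAdjoint.le_adjoint (hA : J.IsJSelfAdjoint A) (hSJ : J.Commutes S)
    (hS : Dense (S.domain : Set H)) (hSA : S ≤ A) : A ≤ S† := by
  refine LinearPMap.le_of_le_graph fun q hq => (hSJ.mem_adjoint_graph_iff hS).2 fun u => ?_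
  have hu := (hA.2 q.1 q.2).1 hq ⟨u, hSA.1 u.2⟩
  rwa [← hSA.2 (x := u) rfl] at hu

/-- The form on boundary values that Green's identity associates with `[·, ·]`: the indefinite inner
product of the Krein space `N_i [∔] (-N_{-i})`. -/
def boundaryForm (J : FundamentalSymmetry H) (p q : defect S Complex.I × defect S (-Complex.I)) :
    ℂ :=
  J.form p.1 q.1 - J.form p.2 q.2

end FundamentalSymmetry

theorem exists_eq_add_defectSum (hS : IsClosedSymmetric S) (hxy : (x, y) ∈ S†.graph)
    (hp : x - defectSum S p ∈ S.domain) : ∃ u : S.domain,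
      x = u + defectSum S p ∧ y = S u + Complex.I • ((p.1 : H) - p.2) :=
  ⟨⟨_, hp⟩, (sub_add_cancel _ _).symm, LinearPMap.mem_graph_snd_inj _ hxy
    (S†.graph.add_mem (hS.apply_mem_adjoint_graph ⟨_, hp⟩) (defectSum_mem_adjoint_graph p))
    (sub_add_cancel _ _).symm⟩

theorem green_identity (hS : IsClosedSymmetric S) (hSJ : J.Commutes S) (hxy : (x, y) ∈ S†.graph)
    (hp : x - defectSum S p ∈ S.domain) {x' y' : H} (hxy' : (x', y') ∈ S†.graph)
    {p' : defect S Complex.I × defect S (-Complex.I)} (hp' : x' - defectSum S p' ∈ S.domain) :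
    J.form y x' - J.form x y' = -(2 * Complex.I) * J.boundaryForm p p' := by
  obtain ⟨u, rfl, rfl⟩ := exists_eq_add_defectSum hS hxy hp
  obtain ⟨u', rfl, rfl⟩ := exists_eq_add_defectSum hS hxy' hp'
  have hu := (hSJ.mem_adjoint_graph_iff hS.dense).1 hxy' u
  have hu' := congrArg (starRingEnd ℂ)
    ((hSJ.mem_adjoint_graph_iff hS.dense).1 (defectSum_mem_adjoint_graph p) u')
  rw [J.conj_form, J.conj_form] at hu'
  simp only [boundaryForm, defectSum_apply, form, map_add, map_sub, map_smul, inner_add_left,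
    inner_add_right, inner_sub_left, inner_sub_right, inner_smul_left, inner_smul_right,
    Complex.conj_I] at hu hu' ⊢
  linear_combination hu - hu'

theorem mem_graph_iff_mem_boundarySpace (hSA : S ≤ A) (hAS : A ≤ S†) (hxy : (x, y) ∈ S†.graph)
    (hp : x - defectSum S p ∈ S.domain) : (x, y) ∈ A.graph ↔ p ∈ boundarySpace S A := by
  rw [← mem_domain_iff_mem_boundarySpace hSA hp]
  refine ⟨A.mem_domain_of_mem_graph, fun hx => ?_⟩
  have hAx : A ⟨x, hx⟩ = y :=
    LinearPMap.mem_graph_snd_inj _ (LinearPMap.le_graph_of_le hAS (A.mem_graph _)) hxy rfl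
  exact hAx ▸ A.mem_graph ⟨x, hx⟩

theorem forall_form_eq_iff_forall_boundaryForm (hS : IsClosedSymmetric S) (hSJ : J.Commutes S)
    (hAS : A ≤ S†) (hSA : S ≤ A)
    (hxy : (x, y) ∈ S†.graph) (hp : x - defectSum S p ∈ S.domain) :
    (∀ u : A.domain, J.form (A u) x = J.form u y) ↔
      ∀ q ∈ boundarySpace S A, J.boundaryForm q p = 0 := by
  have hgreen (u : A.domain) {q} (hq : (u : H) - defectSum S q ∈ S.domain) :
      J.form (A u) x = J.form u y ↔ J.boundaryForm q p = 0 := by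
    rw [← sub_eq_zero, green_identity hS hSJ (LinearPMap.le_graph_of_le hAS (A.mem_graph u)) hq
      hxy hp]
    simp
  constructor
  · intro h q hq
    exact (hgreen ⟨_, hq⟩ (by simp)).1 (h _)
  · intro h u
    obtain ⟨q, hq⟩ := hS.exists_sub_defectSum_mem (hAS.1 u.2)
    exact (hgreen u hq).2 (h q ((mem_domain_iff_mem_boundarySpace hSA hq).1 u.2))

theorem isJSelfAdjoint_iff_isHypermaximalNeutral (hS : IsClosedSymmetric S) (hSJ : J.Commutes S)
    (hSA : S ≤ A) (hAS : A ≤ S†) :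
    J.IsJSelfAdjoint A ↔ IsHypermaximalNeutral J.boundaryForm (boundarySpace S A) := by
  constructor
  · intro hA p
    have hgraph := defectSum_mem_adjoint_graph p
    have hp : defectSum S p - defectSum S p ∈ S.domain := by simp
    rw [← mem_graph_iff_mem_boundarySpace hSA hAS hgraph hp, hA.2,
      forall_form_eq_iff_forall_boundaryForm hS hSJ hAS hSA hgraph hp]
  · refine fun hW => ⟨hS.dense.mono hSA.1, fun x y => ?_⟩
    by_cases hxy : (x, y) ∈ S†.graph
    · obtain ⟨p, hp⟩ := hS.exists_sub_defectSum_mem (LinearPMap.mem_domain_of_mem_graph hxy)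
      rw [mem_graph_iff_mem_boundarySpace hSA hAS hxy hp, hW,
        forall_form_eq_iff_forall_boundaryForm hS hSJ hAS hSA hxy hp]
    · refine iff_of_false (fun h => hxy (LinearPMap.le_graph_of_le hAS h)) fun h => hxy ?_
      refine (hSJ.mem_adjoint_graph_iff hS.dense).2 fun u => ?_
      rw [hSA.2 (x := u) (y := ⟨u, hSA.1 u.2⟩) rfl]
      exact h _

theorem isHypermaximalNeutral_boundaryForm_prod {V : Submodule ℂ (defect S Complex.I)}
    {V' : Submodule ℂ (defect S (-Complex.I))}
    (hV : IsHypermaximalNeutral (fun x y : defect S Complex.I => J.form x y) V)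
    (hV' : IsHypermaximalNeutral (fun x y : defect S (-Complex.I) => J.form x y) V') :
    IsHypermaximalNeutral J.boundaryForm (V.prod V') := by
  intro p
  rw [Submodule.mem_prod, hV, hV']
  constructor
  · rintro ⟨h, h'⟩ q ⟨hq, hq'⟩
    exact sub_eq_zero.2 ((h _ hq).trans (h' _ hq').symm)
  · refine fun h => ⟨fun v hv => ?_, fun v hv => ?_⟩
    · simpa [boundaryForm, form] using h (v, 0) ⟨hv, V'.zero_mem⟩
    · simpa [boundaryForm, form] using h (0, v) ⟨V.zero_mem, hv⟩

end GreenIdentity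

section Dimension

theorem IsHypermaximalNeutral.two_mul_finrank_eq {E F : Type*} [NormedAddCommGroup E]
    [InnerProductSpace ℂ E] [FiniteDimensional ℂ E] [AddCommGroup F] [Module ℂ F]
    (e : F ≃ₗ[ℂ] E) {G : F →ₗ[ℂ] E} (hG : Function.Injective G) {W : Submodule ℂ F}
    (hW : IsHypermaximalNeutral (fun p q => inner ℂ (G p) (e q)) W) :
    2 * Module.finrank ℂ W = Module.finrank ℂ F := by
  have hmap : W.map e.toLinearMap = (W.map G)ᗮ := by
    ext x
    rw [Submodule.mem_map_equiv, hW, Submodule.mem_orthogonal]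
    simp
  have hsum := (W.map G).finrank_add_finrank_orthogonal
  rw [← hmap, LinearEquiv.finrank_map_eq, ← (W.equivMapOfInjective G hG).finrank_eq,
    ← e.finrank_eq] at hsum
  omega

theorem finrank_graph {K E F : Type*} [Field K] [AddCommGroup E] [Module K E] [AddCommGroup F]
    [Module K F] (f : E →ₗ[K] F) : Module.finrank K f.graph = Module.finrank K E := by
  rw [f.graph_eq_range_prod]
  exact LinearMap.finrank_range_of_inj fun x y h => congrArg Prod.fst h

theorem not_disjoint_graph_iff {R E F : Type*} [Ring R] [AddCommGroup E] [Module R E]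
    [AddCommGroup F] [Module R F] {W : Submodule R (E × F)} {f : E →ₗ[R] F} :
    ¬Disjoint W f.graph ↔ ∃ x ≠ 0, (x, f x) ∈ W := by
  rw [Submodule.disjoint_def]
  push Not
  constructor
  · rintro ⟨⟨x, y⟩, hW, hxy, hne⟩
    obtain rfl : y = f x := (f.mem_graph_iff _).1 hxy
    exact ⟨x, fun hx => hne (by simp [hx]), hW⟩
  · rintro ⟨x, hx, hW⟩
    exact ⟨_, hW, (f.mem_graph_iff _).2 rfl, fun h => hx (congrArg Prod.fst h)⟩

variable {H : Type*} [NormedAddCommGroup H] [InnerProductSpace ℂ H] [CompleteSpace H]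
  {J : FundamentalSymmetry H} {S A : H →ₗ.[ℂ] H}

theorem FundamentalSymmetry.Commutes.op_mem_defect (hSJ : J.Commutes S)
    (hS : Dense (S.domain : Set H)) {z : ℂ} {x : H} (hx : x ∈ defect S z) :
    J.op x ∈ defect S z := by
  rw [mem_defect, hSJ.mem_adjoint_graph_iff hS]
  intro u
  rw [form, form, J.inner_op, J.inner_op, map_smul, J.sq]
  exact (mem_adjoint_graph hS).1 hx u

theorem two_mul_finrank_of_isHypermaximalNeutral_boundaryForm (hS : Dense (S.domain : Set H))
    (hSJ : J.Commutes S) [FiniteDimensional ℂ (defect S Complex.I)]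
    [FiniteDimensional ℂ (defect S (-Complex.I))]
    {W : Submodule ℂ (defect S Complex.I × defect S (-Complex.I))}
    (hW : IsHypermaximalNeutral J.boundaryForm W) :
    2 * Module.finrank ℂ W =
      Module.finrank ℂ (defect S Complex.I) + Module.finrank ℂ (defect S (-Complex.I)) := by
  let e := (WithLp.linearEquiv 2 ℂ (defect S Complex.I × defect S (-Complex.I))).symm
  let opDefect (z : ℂ) : defect S z →ₗ[ℂ] defect S z :=
    (J.op : H →ₗ[ℂ] H).restrict fun _ => hSJ.op_mem_defect hS
  have hop (z : ℂ) : Function.Injective (opDefect z) := fun x y hxy =>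
    Subtype.ext <| J.op_injective <| congrArg Subtype.val hxy
  have hG : Function.Injective ((opDefect Complex.I).prodMap (-opDefect (-Complex.I))) :=
    (hop _).prodMap (neg_injective.comp (hop _))
  have hB : J.boundaryForm = fun p q =>
      inner ℂ (e ((opDefect Complex.I).prodMap (-opDefect (-Complex.I)) p)) (e q) := by
    funext p q
    change _ = inner ℂ (J.op p.1) (q.1 : H) + inner ℂ (-J.op p.2) (q.2 : H)
    rw [inner_neg_left, ← sub_eq_add_neg]
    rfl
  rw [hB] at hW
  rw [← Module.finrank_prod]
  exact hW.two_mul_finrank_eq e (G := e.toLinearMap ∘ₗ _) (e.injective.comp hG)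

theorem resolventSet_eq_empty_iff_forall_exists_mem_boundarySpace (hS : IsClosedSymmetric S)
    (hSJ : J.Commutes S) (hSA : S ≤ A) (hA : J.IsJSelfAdjoint A)
    [FiniteDimensional ℂ (defect S Complex.I)] [FiniteDimensional ℂ (defect S (-Complex.I))]
    (hdim : Module.finrank ℂ (defect S (-Complex.I)) ≤ Module.finrank ℂ (defect S Complex.I)) :
    resolventSet A = ∅ ↔ ∀ (μ : ℂ) (hμ : 0 < μ.im),
      ∃ f ≠ 0, (f, -straus hS μ hμ f) ∈ boundarySpace S A := by
  have hAS := hA.le_adjoint hSJ hS.dense hSA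
  have hW := two_mul_finrank_of_isHypermaximalNeutral_boundaryForm hS.dense hSJ
    ((isJSelfAdjoint_iff_isHypermaximalNeutral hS hSJ hSA hAS).1 hA)
  rw [hA.resolventSet_eq_empty_iff]
  refine forall₂_congr fun μ hμ => ?_
  rw [mem_resolventSet_iff_isCompl hS hA.isClosed hSA hAS hμ, Submodule.isCompl_iff_disjoint,
    not_disjoint_graph_iff]
  · rfl
  · rw [Module.finrank_prod, finrank_graph]
    omega

end Dimension

section ReducingSubspace

variable {H : Type*} [NormedAddCommGroup H] [InnerProductSpace ℂ H] [CompleteSpace H]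
  {T : H →ₗ.[ℂ] H} {K : Submodule ℂ H} [CompleteSpace K]
  {hK : ∀ x : T.domain, (x : H) ∈ K → T x ∈ K}

theorem mem_defect_restrict_iff
    (hKT : ∀ x y, (x, y) ∈ T.graph → (K.starProjection x, K.starProjection y) ∈ T.graph)
    (hT : IsClosedSymmetric T) (hT' : IsClosedSymmetric (restrict T K hK)) {z : ℂ} {x : K} :
    x ∈ defect (restrict T K hK) z ↔ (x : H) ∈ defect T z := by
  have hproj (a : H) : inner ℂ (K.starProjection a) (x : H) = inner ℂ a (x : H) := by
    rw [K.inner_starProjection_left_eq_right, K.starProjection_eq_self_iff.2 x.2]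
  rw [mem_defect, mem_defect, mem_adjoint_graph hT'.dense, mem_adjoint_graph hT.dense]
  constructor
  · intro h u
    have hPTu := hKT u (T u) (T.mem_graph u)
    have hPu := T.mem_domain_of_mem_graph hPTu
    have hTPu : T ⟨K.starProjection u, hPu⟩ = K.starProjection (T u) :=
      T.mem_graph_snd_inj (T.mem_graph ⟨_, hPu⟩) hPTu rfl
    have hux := h ⟨⟨K.starProjection u, K.starProjection_apply_mem u⟩, hPu⟩
    change inner ℂ (T ⟨K.starProjection u, hPu⟩) (x : H) =
      inner ℂ (K.starProjection u) (z • (x : H)) at hux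
    rwa [hTPu, inner_smul_right, hproj, hproj, ← inner_smul_right] at hux
  · exact fun h u => h ⟨u, u.2⟩

theorem coe_straus_restrict
    (hKT : ∀ x y, (x, y) ∈ T.graph → (K.starProjection x, K.starProjection y) ∈ T.graph)
    (hT : IsClosedSymmetric T) (hT' : IsClosedSymmetric (restrict T K hK)) {μ : ℂ} (hμ : 0 < μ.im)
    {e : defect (restrict T K hK) Complex.I} {f : defect T Complex.I} (hef : ((e : K) : H) = f) :
    ((straus hT' μ hμ e : K) : H) = straus hT μ hμ f := by
  have hmem {z : ℂ} {x : K} (hx : x ∈ defect (restrict T K hK) z) : (x : H) ∈ defect T z :=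
    (mem_defect_restrict_iff hKT hT hT').1 hx
  have hstraus : (e : K) - straus hT' μ hμ e ∈
      (restrict T K hK).domain ⊔ defect (restrict T K hK) μ := (straus_apply_eq_iff hT' hμ).1 rfl
  obtain ⟨u, hu, n, hn, hun⟩ := Submodule.mem_sup.1 hstraus
  refine (congrArg Subtype.val
    ((straus_apply_eq_iff hT hμ (e' := ⟨_, hmem (straus hT' μ hμ e).2⟩)).2 ?_)).symm
  rw [← hef, ← Submodule.coe_sub, ← hun]
  exact Submodule.add_mem_sup hu (hmem hn)

end ReducingSubspace

section Parts

variable {H : Type*} [NormedAddCommGroup H] [InnerProductSpace ℂ H] [CompleteSpace H]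
  {J : FundamentalSymmetry H} {S : H →ₗ.[ℂ] H}

namespace FundamentalSymmetry

theorem inner_eq_zero_of_mem_plus_of_mem_minus (J : FundamentalSymmetry H) {x y : H}
    (hx : x ∈ J.plus) (hy : y ∈ J.minus) : inner ℂ x y = 0 := by
  have h := J.inner_op x y
  rw [J.mem_plus.1 hx, J.mem_minus.1 hy, inner_neg_right] at h
  exact self_eq_neg.1 h

theorem projPlus_add_projMinus (J : FundamentalSymmetry H) (x : H) :
    J.projPlus x + J.projMinus x = x := by
  rw [projPlus_apply, projMinus_apply]
  module

theorem starProjection_plus (J : FundamentalSymmetry H) : J.plus.starProjection = J.projPlus := by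
  ext x
  refine Submodule.eq_starProjection_of_mem_of_inner_eq_zero ⟨x, rfl⟩ fun w hw => ?_
  rw [sub_eq_of_eq_add' (J.projPlus_add_projMinus x).symm, inner_eq_zero_symm]
  exact J.inner_eq_zero_of_mem_plus_of_mem_minus hw ⟨x, rfl⟩

theorem starProjection_minus (J : FundamentalSymmetry H) :
    J.minus.starProjection = J.projMinus := by
  ext x
  refine Submodule.eq_starProjection_of_mem_of_inner_eq_zero ⟨x, rfl⟩ fun w hw => ?_
  rw [sub_eq_of_eq_add (J.projPlus_add_projMinus x).symm]
  exact J.inner_eq_zero_of_mem_plus_of_mem_minus ⟨x, rfl⟩ hw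

theorem Commutes.op_mem_graph (hSJ : J.Commutes S) {x y : H} (h : (x, y) ∈ S.graph) :
    (J.op x, J.op y) ∈ S.graph := by
  obtain ⟨u, rfl, rfl⟩ := S.mem_graph_iff.1 h
  exact S.mem_graph_iff.2 ⟨⟨_, (hSJ.1 u).2 u.2⟩, rfl, hSJ.2 u _ u.2⟩

theorem Commutes.starProjection_plus_mem_graph (hSJ : J.Commutes S) (x y : H)
    (h : (x, y) ∈ S.graph) : (J.plus.starProjection x, J.plus.starProjection y) ∈ S.graph := by
  rw [starProjection_plus]
  exact S.graph.smul_mem _ (S.graph.add_mem h (hSJ.op_mem_graph h))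

theorem Commutes.starProjection_minus_mem_graph (hSJ : J.Commutes S) (x y : H)
    (h : (x, y) ∈ S.graph) : (J.minus.starProjection x, J.minus.starProjection y) ∈ S.graph := by
  rw [starProjection_minus]
  exact S.graph.smul_mem _ (S.graph.sub_mem h (hSJ.op_mem_graph h))

end FundamentalSymmetry

/-- The defect spaces of `S₊` as subspaces of those of `S`. -/
def plusDefectInclusion (hS : IsClosedSymmetric S) (hSJ : J.Commutes S) (z : ℂ) :
    defect (plusPart S hSJ) z →ₗ[ℂ] defect S z :=
  (J.plus.subtype ∘ₗ (defect (plusPart S hSJ) z).subtype).codRestrict (defect S z) fun e =>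
    (mem_defect_restrict_iff hSJ.starProjection_plus_mem_graph hS (hS.plusPart hSJ)).1 e.2

/-- The defect spaces of `S₋` as subspaces of those of `S`. -/
def minusDefectInclusion (hS : IsClosedSymmetric S) (hSJ : J.Commutes S) (z : ℂ) :
    defect (minusPart S hSJ) z →ₗ[ℂ] defect S z :=
  (J.minus.subtype ∘ₗ (defect (minusPart S hSJ) z).subtype).codRestrict (defect S z) fun e =>
    (mem_defect_restrict_iff hSJ.starProjection_minus_mem_graph hS (hS.minusPart hSJ)).1 e.2

theorem straus_plusDefectInclusion (hS : IsClosedSymmetric S) (hSJ : J.Commutes S) {μ : ℂ}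
    (hμ : 0 < μ.im) (e : defect (plusPart S hSJ) Complex.I) :
    straus hS μ hμ (plusDefectInclusion hS hSJ _ e) =
      plusDefectInclusion hS hSJ _ (straus (hS.plusPart hSJ) μ hμ e) :=
  Subtype.ext
    (coe_straus_restrict hSJ.starProjection_plus_mem_graph hS (hS.plusPart hSJ) hμ rfl).symm

theorem straus_minusDefectInclusion (hS : IsClosedSymmetric S) (hSJ : J.Commutes S) {μ : ℂ}
    (hμ : 0 < μ.im) (e : defect (minusPart S hSJ) Complex.I) :
    straus hS μ hμ (minusDefectInclusion hS hSJ _ e) =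
      minusDefectInclusion hS hSJ _ (straus (hS.minusPart hSJ) μ hμ e) :=
  Subtype.ext
    (coe_straus_restrict hSJ.starProjection_minus_mem_graph hS (hS.minusPart hSJ) hμ rfl).symm

theorem exists_eq_plusDefectInclusion_add_minusDefectInclusion (hS : IsClosedSymmetric S)
    (hSJ : J.Commutes S) {z : ℂ} (x : defect S z) :
    ∃ e e', x = plusDefectInclusion hS hSJ z e + minusDefectInclusion hS hSJ z e' := by
  have hJx := hSJ.op_mem_defect hS.dense x.2
  have hplus : J.projPlus x ∈ defect S z :=
    (defect S z).smul_mem _ ((defect S z).add_mem x.2 hJx)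
  have hminus : J.projMinus x ∈ defect S z :=
    (defect S z).smul_mem _ ((defect S z).sub_mem x.2 hJx)
  refine ⟨⟨⟨J.projPlus x, x, rfl⟩, ?_⟩, ⟨⟨J.projMinus x, x, rfl⟩, ?_⟩,
    Subtype.ext (J.projPlus_add_projMinus x).symm⟩
  · exact (mem_defect_restrict_iff hSJ.starProjection_plus_mem_graph hS (hS.plusPart hSJ)).2 hplus
  · exact
      (mem_defect_restrict_iff hSJ.starProjection_minus_mem_graph hS (hS.minusPart hSJ)).2 hminus

end Parts

theorem norm_eq_norm_of_conj_mul_self_eq {z w : ℂ}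
    (h : starRingEnd ℂ z * z = starRingEnd ℂ w * w) : ‖z‖ = ‖w‖ := by
  rw [Complex.conj_mul', Complex.conj_mul'] at h
  exact (sq_eq_sq₀ (norm_nonneg z) (norm_nonneg w)).1 (by exact_mod_cast h)

theorem exists_norm_eq_one_mul_eq_of_conj_mul_eq {ι : Type*} {s t : ι → ℂ}
    (h : ∀ i j, starRingEnd ℂ (s i) * s j = starRingEnd ℂ (t i) * t j) :
    ∃ c : ℂ, ‖c‖ = 1 ∧ ∀ i, c * s i = t i := by
  have hnorm (i : ι) : ‖s i‖ = ‖t i‖ := norm_eq_norm_of_conj_mul_self_eq (h i i)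
  by_cases hs : ∃ i, s i ≠ 0
  · obtain ⟨i, hi⟩ := hs
    refine ⟨t i / s i, by rw [norm_div, ← hnorm, div_self (norm_ne_zero_iff.2 hi)], fun j => ?_⟩
    have hti : t i ≠ 0 := norm_ne_zero_iff.1 (hnorm i ▸ norm_ne_zero_iff.2 hi)
    have hti' : starRingEnd ℂ (t i) ≠ 0 := (map_ne_zero _).2 hti
    rw [div_mul_eq_mul_div, div_eq_iff hi]
    refine mul_left_cancel₀ hti' ?_
    linear_combination s j * (h i i).symm + s i * h i j
  · push Not at hs
    exact ⟨1, norm_one, fun j => by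
      rw [hs, mul_zero, eq_comm, ← norm_eq_zero, ← hnorm, hs, norm_zero]⟩

/-- `p` and `m` form a basis of the subspace `N` that consists of a `J`-positive and a `J`-negative
vector of equal norm, so that `[·, ·]` has the Gram matrix `‖p‖² diag(1, -1)` in it. -/
structure FundamentalSymmetry.IsFundamentalBasis {H : Type*} [NormedAddCommGroup H]
    [InnerProductSpace ℂ H] [CompleteSpace H] (J : FundamentalSymmetry H) (N : Submodule ℂ H)
    (p m : N) : Prop where
  mem_plus : (p : H) ∈ J.plus
  mem_minus : (m : H) ∈ J.minus
  ne_zero : p ≠ 0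
  norm_eq : ‖m‖ = ‖p‖
  span_eq_top : Submodule.span ℂ {p, m} = ⊤

namespace FundamentalSymmetry.IsFundamentalBasis

variable {H : Type*} [NormedAddCommGroup H] [InnerProductSpace ℂ H] [CompleteSpace H]
  {J : FundamentalSymmetry H} {N : Submodule ℂ H} {p m : N}

theorem form_apply (h : J.IsFundamentalBasis N p m) (a b a' b' : ℂ) :
    J.form (a • p + b • m : N) (a' • p + b' • m : N) =
      (‖p‖ : ℂ) ^ 2 * (starRingEnd ℂ a * a' - starRingEnd ℂ b * b') := by
  have hp : inner ℂ (p : H) p = (‖p‖ : ℂ) ^ 2 := inner_self_eq_norm_sq_to_K p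
  have hm : inner ℂ (m : H) m = (‖p‖ : ℂ) ^ 2 := h.norm_eq ▸ inner_self_eq_norm_sq_to_K m
  have hpm := J.inner_eq_zero_of_mem_plus_of_mem_minus h.mem_plus h.mem_minus
  have hmp := inner_eq_zero_symm.1 hpm
  simp only [form, Submodule.coe_add, Submodule.coe_smul, map_add, map_smul,
    J.mem_plus.1 h.mem_plus, J.mem_minus.1 h.mem_minus, inner_add_left, inner_add_right,
    inner_smul_left, inner_smul_right, inner_neg_left, hp, hm, hpm, hmp]
  ring

theorem form_eq_zero_iff (h : J.IsFundamentalBasis N p m) {a b a' b' : ℂ} :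
    J.form (a • p + b • m : N) (a' • p + b' • m : N) = 0 ↔
      starRingEnd ℂ a * a' = starRingEnd ℂ b * b' := by
  rw [h.form_apply, mul_eq_zero_iff_left (by simpa using h.ne_zero), sub_eq_zero]

theorem exists_eq_smul_add_smul (h : J.IsFundamentalBasis N p m) (x : N) :
    ∃ a b : ℂ, x = a • p + b • m := by
  obtain ⟨a, b, hx⟩ := Submodule.mem_span_pair.1 (h.span_eq_top ▸ Submodule.mem_top : x ∈ _)
  exact ⟨a, b, hx.symm⟩

theorem linearIndependent (h : J.IsFundamentalBasis N p m) : LinearIndependent ℂ ![p, m] := by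
  rw [LinearIndependent.pair_iff]
  intro a b hab
  have hcoef (c d : ℂ) : c * a = d * b := by
    have hcd := h.form_eq_zero_iff (a := starRingEnd ℂ c) (b := starRingEnd ℂ d) (a' := a) (b' := b)
    rw [Complex.conj_conj, Complex.conj_conj, hab] at hcd
    exact hcd.1 (by simp [form])
  exact ⟨by simpa using hcoef 1 0, by simpa using (hcoef 0 1).symm⟩

theorem add_smul_ne_zero (h : J.IsFundamentalBasis N p m) (c : ℂ) : p + c • m ≠ 0 := fun hc =>
  one_ne_zero (LinearIndependent.pair_iff.1 h.linearIndependent 1 c (by rwa [one_smul])).1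

theorem finiteDimensional (h : J.IsFundamentalBasis N p m) : FiniteDimensional ℂ N :=
  ⟨h.span_eq_top ▸ Submodule.fg_span (Set.toFinite _)⟩

theorem finrank_eq_two (h : J.IsFundamentalBasis N p m) : Module.finrank ℂ N = 2 := by
  rw [← finrank_top, ← h.span_eq_top, ← Matrix.range_cons_cons_empty,
    finrank_span_eq_card h.linearIndependent, Fintype.card_fin]

theorem mem_span_singleton_iff_form_eq_zero (h : J.IsFundamentalBasis N p m) {c : ℂ}
    (hc : ‖c‖ = 1) {x : N} :
    x ∈ Submodule.span ℂ {p + c • m} ↔ J.form (p + c • m : N) x = 0 := by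
  have hcc : starRingEnd ℂ c * c = 1 := by rw [Complex.conj_mul', hc, Complex.ofReal_one, one_pow]
  have hform (a b : ℂ) :
      J.form (p + c • m : N) (a • p + b • m : N) = 0 ↔ a = starRingEnd ℂ c * b := by
    simpa only [one_smul, map_one, one_mul] using h.form_eq_zero_iff (a := 1) (b := c)
  rw [Submodule.mem_span_singleton]
  constructor
  · rintro ⟨k, rfl⟩
    rw [smul_add, smul_smul, hform, mul_left_comm, hcc, mul_one]
  · obtain ⟨a, b, rfl⟩ := h.exists_eq_smul_add_smul x
    rw [hform]
    rintro rfl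
    exact ⟨starRingEnd ℂ c * b, by rw [smul_add, smul_smul, mul_right_comm, hcc, one_mul]⟩

theorem isHypermaximalNeutral_span_singleton (h : J.IsFundamentalBasis N p m) {c : ℂ}
    (hc : ‖c‖ = 1) :
    IsHypermaximalNeutral (fun x y : N => J.form x y) (Submodule.span ℂ {p + c • m}) := by
  intro x
  rw [h.mem_span_singleton_iff_form_eq_zero hc]
  refine ⟨fun hx q hq => ?_, fun hx => hx _ (Submodule.mem_span_singleton_self _)⟩
  obtain ⟨k, rfl⟩ := Submodule.mem_span_singleton.1 hq
  change J.form (k • (p + c • m : N) : H) x = 0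
  rw [form, map_smul, inner_smul_left]
  exact mul_eq_zero_of_right _ hx

theorem exists_eq_smul_of_form_self_eq_zero (h : J.IsFundamentalBasis N p m) {x : N} (hx : x ≠ 0)
    (hxx : J.form x x = 0) : ∃ c : ℂ, ‖c‖ = 1 ∧ ∃ a : ℂ, a ≠ 0 ∧ x = a • (p + c • m) := by
  obtain ⟨a, b, rfl⟩ := h.exists_eq_smul_add_smul x
  have hab : ‖a‖ = ‖b‖ := norm_eq_norm_of_conj_mul_self_eq (h.form_eq_zero_iff.1 hxx)
  have ha : a ≠ 0 := by
    rintro rfl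
    rw [norm_zero, eq_comm, norm_eq_zero] at hab
    exact hx (by rw [hab, zero_smul, zero_smul, add_zero])
  refine ⟨b / a, by rw [norm_div, hab, div_self (hab ▸ norm_ne_zero_iff.2 ha)], a, ha, ?_⟩
  rw [smul_add, smul_smul, mul_div_cancel₀ _ ha]

end FundamentalSymmetry.IsFundamentalBasis

section Characterization

variable {H : Type*} [NormedAddCommGroup H] [InnerProductSpace ℂ H] [CompleteSpace H]
  {J : FundamentalSymmetry H} {S : H →ₗ.[ℂ] H}

theorem isFundamentalBasis_defect (hS : IsClosedSymmetric S) (hSJ : J.Commutes S) {z : ℂ}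
    {e : defect (plusPart S hSJ) z} {e' : defect (minusPart S hSJ) z}
    (he : Submodule.span ℂ {e} = ⊤) (he' : Submodule.span ℂ {e'} = ⊤) (hne : e ≠ 0)
    (hnorm : ‖e'‖ = ‖e‖) :
    J.IsFundamentalBasis (defect S z) (plusDefectInclusion hS hSJ z e)
      (minusDefectInclusion hS hSJ z e') where
  mem_plus := (e : J.plus).2
  mem_minus := (e' : J.minus).2
  ne_zero h := hne (norm_eq_zero.1 ((congrArg norm h).trans norm_zero))
  norm_eq := hnorm
  span_eq_top := by
    refine Submodule.eq_top_iff'.2 fun x => Submodule.mem_span_pair.2 ?_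
    obtain ⟨y, y', rfl⟩ := exists_eq_plusDefectInclusion_add_minusDefectInclusion hS hSJ x
    obtain ⟨a, rfl⟩ := Submodule.mem_span_singleton.1 (he ▸ Submodule.mem_top : y ∈ _)
    obtain ⟨b, rfl⟩ := Submodule.mem_span_singleton.1 (he' ▸ Submodule.mem_top : y' ∈ _)
    exact ⟨a, b, by rw [map_smul, map_smul]⟩

variable {f f' : defect S Complex.I} {g g' : defect S (-Complex.I)} {s s' : ℂ → ℂ}
  {W : Submodule ℂ (defect S Complex.I × defect S (-Complex.I))}

theorem exists_forall_mem_of_isHypermaximalNeutral (hS : IsClosedSymmetric S)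
    (hf : J.IsFundamentalBasis (defect S Complex.I) f f')
    (hW : IsHypermaximalNeutral J.boundaryForm W)
    (hstraus : ∀ (μ : ℂ) (hμ : 0 < μ.im), ∃ k ≠ 0, (k, -straus hS μ hμ k) ∈ W) :
    ∃ d : ℂ, ‖d‖ = 1 ∧ ∀ (μ : ℂ) (hμ : 0 < μ.im),
      (f + d • f', -straus hS μ hμ (f + d • f')) ∈ W := by
  obtain ⟨k₀, hk₀, hk₀W⟩ := hstraus Complex.I (by simp)
  rw [straus_I, LinearMap.zero_apply, neg_zero] at hk₀W
  have hform {x y} (hx : (x, y) ∈ W) : J.form k₀ x = 0 := by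
    simpa [boundaryForm, form] using (hW _).1 hx _ hk₀W
  obtain ⟨d, hd, a, ha, rfl⟩ := hf.exists_eq_smul_of_form_self_eq_zero hk₀ (hform hk₀W)
  refine ⟨d, hd, fun μ hμ => ?_⟩
  obtain ⟨k, hk, hkW⟩ := hstraus μ hμ
  have hkspan : k ∈ Submodule.span ℂ {f + d • f'} := by
    have h := hform hkW
    rw [Submodule.coe_smul, form, map_smul, inner_smul_left] at h
    exact (hf.mem_span_singleton_iff_form_eq_zero hd).2
      ((mul_eq_zero_iff_left ((map_ne_zero _).2 ha)).1 h)
  obtain ⟨b, rfl⟩ := Submodule.mem_span_singleton.1 hkspan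
  rw [map_smul, ← smul_neg, ← Prod.smul_mk] at hkW
  exact (W.smul_mem_iff (left_ne_zero_of_smul hk)).1 hkW

theorem conj_mul_eq_of_forall_mem (hS : IsClosedSymmetric S)
    (hf : J.IsFundamentalBasis (defect S Complex.I) f f')
    (hg : J.IsFundamentalBasis (defect S (-Complex.I)) g g')
    (hs : ∀ (μ : ℂ) (hμ : 0 < μ.im), straus hS μ hμ f = s μ • g)
    (hs' : ∀ (μ : ℂ) (hμ : 0 < μ.im), straus hS μ hμ f' = s' μ • g')
    (hW : IsHypermaximalNeutral J.boundaryForm W) {d : ℂ} (hd : ‖d‖ = 1)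
    (hdW : ∀ (μ : ℂ) (hμ : 0 < μ.im), (f + d • f', -straus hS μ hμ (f + d • f')) ∈ W)
    {ν μ : ℂ} (hν : 0 < ν.im) (hμ : 0 < μ.im) :
    starRingEnd ℂ (s ν) * s μ = starRingEnd ℂ (s' ν) * s' μ := by
  have hdd : starRingEnd ℂ d * d = 1 := by rw [Complex.conj_mul', hd, Complex.ofReal_one, one_pow]
  have hstraus {μ : ℂ} (hμ : 0 < μ.im) :
      -straus hS μ hμ (f + d • f') = (-s μ) • g + (-(d * s' μ)) • g' := by
    rw [map_add, map_smul, hs, hs']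
    module
  have hneutral : J.form (f + d • f' : defect S Complex.I) (f + d • f' : defect S Complex.I) = 0 :=
    (hf.mem_span_singleton_iff_form_eq_zero hd).1 (Submodule.mem_span_singleton_self _)
  have hform := (hW _).1 (hdW μ hμ) _ (hdW ν hν)
  rw [boundaryForm, hneutral, zero_sub, neg_eq_zero, hstraus, hstraus,
    hg.form_eq_zero_iff] at hform
  simp only [map_neg, map_mul] at hform
  linear_combination hform + starRingEnd ℂ (s' ν) * s' μ * hdd

theorem isJSelfAdjoint_extension_prod_span_singleton (hS : IsClosedSymmetric S)
    (hSJ : J.Commutes S) (hf : J.IsFundamentalBasis (defect S Complex.I) f f')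
    (hg : J.IsFundamentalBasis (defect S (-Complex.I)) g g') {c d : ℂ} (hc : ‖c‖ = 1)
    (hd : ‖d‖ = 1) :
    J.IsJSelfAdjoint (extension S
      ((Submodule.span ℂ {f + c • f'}).prod (Submodule.span ℂ {g + d • g'}))) := by
  rw [isJSelfAdjoint_iff_isHypermaximalNeutral hS hSJ (le_extension _ hS) (extension_le_adjoint _),
    boundarySpace_extension _ hS]
  exact isHypermaximalNeutral_boundaryForm_prod (hf.isHypermaximalNeutral_span_singleton hc)
    (hg.isHypermaximalNeutral_span_singleton hd)

theorem exists_isJSelfAdjoint_resolventSet_eq_empty_iff (hS : IsClosedSymmetric S)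
    (hSJ : J.Commutes S) (hf : J.IsFundamentalBasis (defect S Complex.I) f f')
    (hg : J.IsFundamentalBasis (defect S (-Complex.I)) g g')
    (hs : ∀ (μ : ℂ) (hμ : 0 < μ.im), straus hS μ hμ f = s μ • g)
    (hs' : ∀ (μ : ℂ) (hμ : 0 < μ.im), straus hS μ hμ f' = s' μ • g') :
    (∃ A : H →ₗ.[ℂ] H, S ≤ A ∧ J.IsJSelfAdjoint A ∧ resolventSet A = ∅) ↔
      ∃ c : ℂ, ‖c‖ = 1 ∧ ∀ μ : ℂ, 0 < μ.im → c * s μ = s' μ := by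
  have := hf.finiteDimensional
  have := hg.finiteDimensional
  have hdim := (hg.finrank_eq_two.trans hf.finrank_eq_two.symm).le
  constructor
  · rintro ⟨A, hSA, hA, hρ⟩
    have hW := (isJSelfAdjoint_iff_isHypermaximalNeutral hS hSJ hSA
      (hA.le_adjoint hSJ hS.dense hSA)).1 hA
    obtain ⟨d, hd, hdW⟩ := exists_forall_mem_of_isHypermaximalNeutral hS hf hW
      ((resolventSet_eq_empty_iff_forall_exists_mem_boundarySpace hS hSJ hSA hA hdim).1 hρ)
    obtain ⟨c, hc, hcs⟩ := exists_norm_eq_one_mul_eq_of_conj_mul_eq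
      (s := fun μ : {μ : ℂ // 0 < μ.im} => s μ) (t := fun μ => s' μ) fun ν μ =>
        conj_mul_eq_of_forall_mem hS hf hg hs hs' hW hd hdW ν.2 μ.2
    exact ⟨c, hc, fun μ hμ => hcs ⟨μ, hμ⟩⟩
  · rintro ⟨c, hc, hcs⟩
    have hA := isJSelfAdjoint_extension_prod_span_singleton hS hSJ hf hg norm_one hc
    refine ⟨_, le_extension _ hS, hA, ?_⟩
    rw [resolventSet_eq_empty_iff_forall_exists_mem_boundarySpace hS hSJ (le_extension _ hS) hA
      hdim, boundarySpace_extension _ hS]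
    refine fun μ hμ => ⟨_, hf.add_smul_ne_zero 1, Submodule.mem_span_singleton_self _, ?_⟩
    refine Submodule.mem_span_singleton.2 ⟨-s μ, ?_⟩
    rw [map_add, map_smul, hs, hs', ← hcs μ hμ]
    module

end Characterization

end KreinExt

end

theorem theorem3p1 {H : Type*} [NormedAddCommGroup H] [InnerProductSpace ℂ H] [CompleteSpace H]
    (J : KreinExt.FundamentalSymmetry H) (S : H →ₗ.[ℂ] H) (hS : KreinExt.IsClosedSymmetric S)
    (hSJ : J.Commutes S)
    (hplus : KreinExt.HasDeficiencyIndicesOneOne (KreinExt.plusPart S hSJ))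
    (hminus : KreinExt.HasDeficiencyIndicesOneOne (KreinExt.minusPart S hSJ))
    (epp : KreinExt.defect (KreinExt.plusPart S hSJ) Complex.I)
    (emp : KreinExt.defect (KreinExt.plusPart S hSJ) (-Complex.I))
    (epm : KreinExt.defect (KreinExt.minusPart S hSJ) Complex.I)
    (emm : KreinExt.defect (KreinExt.minusPart S hSJ) (-Complex.I))
    (hepp : Submodule.span ℂ {epp} = ⊤) (hemp : Submodule.span ℂ {emp} = ⊤)
    (hepm : Submodule.span ℂ {epm} = ⊤) (hemm : Submodule.span ℂ {emm} = ⊤)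
    (hnorm_mp : ‖emp‖ = ‖epp‖) (hnorm_pm : ‖epm‖ = ‖epp‖) (hnorm_mm : ‖emm‖ = ‖epp‖)
    (splus sminus : ℂ → ℂ)
    (hsplus : ∀ (μ : ℂ) (hμ : 0 < μ.im),
      KreinExt.straus (hS.plusPart hSJ) μ hμ epp = splus μ • emp)
    (hsminus : ∀ (μ : ℂ) (hμ : 0 < μ.im),
      KreinExt.straus (hS.minusPart hSJ) μ hμ epm = sminus μ • emm) :
    (∃ A : H →ₗ.[ℂ] H, S ≤ A ∧ J.IsJSelfAdjoint A ∧ KreinExt.resolventSet A = ∅) ↔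
      ∃ c : ℂ, ‖c‖ = 1 ∧ ∀ μ : ℂ, 0 < μ.im → c * splus μ = sminus μ := by
  have hepp0 : epp ≠ 0 := by
    rintro rfl
    have hfinrank := hplus.1
    rw [← finrank_top, ← hepp, Submodule.span_zero_singleton, finrank_bot] at hfinrank
    exact zero_ne_one hfinrank
  have hemp0 : emp ≠ 0 := norm_ne_zero_iff.1 (hnorm_mp ▸ norm_ne_zero_iff.2 hepp0)
  refine KreinExt.exists_isJSelfAdjoint_resolventSet_eq_empty_iff hS hSJ
    (KreinExt.isFundamentalBasis_defect hS hSJ hepp hepm hepp0 hnorm_pm)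
    (KreinExt.isFundamentalBasis_defect hS hSJ hemp hemm hemp0 (hnorm_mm.trans hnorm_mp.symm))
    (fun μ hμ => ?_) fun μ hμ => ?_
  · rw [KreinExt.straus_plusDefectInclusion, hsplus, map_smul]
  · rw [KreinExt.straus_minusDefectInclusion, hsminus, map_smul]
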